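/- For a finite simple graph $G=(V,E)$, let $\Gamma(G)=\langle x_v\ (v\in V)\mid x_ux_v=x_vx_u \text{ whenever } \{u,v\}\in E\rangle$ be its right-angled Artin group. Let $M^1$ be either the closed interval $I=[0,1]$ or the circle $\mathbb{S}^1$, and let $\mathrm{Diff}^{\omega}_+(M^1)$ be the group of orientation-preserving real-analytic diffeomorphisms of $M^1$ (on $I$, analytic up to and including the endpoints). Then, for each of the two choices of $M^1$, there is an injective group homomorphism $\Gamma(G)\to\mathrm{Diff}^{\omega}_+(M^1)$ if and only if every connected component of $G$ is a complete graph. -/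

import Mathlib

open scoped Manifold ContDiff

/-- The right-angled Artin group of a simple graph: one generator for each vertex, and the relation
that two generators commute for each pair of adjacent vertices. -/
abbrev RAAG {V : Type*} (G : SimpleGraph V) : Type _ :=
  PresentedGroup {r : FreeGroup V | ∃ u v : V, G.Adj u v ∧
    r = FreeGroup.of u * FreeGroup.of v * (FreeGroup.of u)⁻¹ * (FreeGroup.of v)⁻¹}

/-- The self-diffeomorphisms of class `C^n` of a manifold form a group under composition. -/
noncomputable instance Diffeomorph.selfGroup {E H M : Type*} [NormedAddCommGroup E] [NormedSpace ℝ E]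
    [TopologicalSpace H] (I : ModelWithCorners ℝ E H) [TopologicalSpace M] [ChartedSpace H M]
    (n : ℕ∞ω) : Group (Diffeomorph I I M M n) where
  mul f g := g.trans f
  one := Diffeomorph.refl I M n
  inv f := f.symm
  mul_assoc _ _ _ := rfl
  one_mul _ := rfl
  mul_one _ := rfl
  inv_mul_cancel f := Diffeomorph.ext fun x => f.symm_apply_apply x

/-- The group of orientation-preserving real-analytic diffeomorphisms of the closed interval
`[0, 1]`, as a manifold with boundary (so analytic maps extend analytically past the endpoints):
on the interval, preserving the orientation means being increasing. -/
def DiffAnalyticInterval :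
    Subgroup (Diffeomorph (𝓡∂ 1) (𝓡∂ 1) (Set.Icc (0 : ℝ) 1) (Set.Icc (0 : ℝ) 1) ω) where
  carrier := {f | StrictMono f}
  mul_mem' {f g} hf hg := fun _ _ h => hf (hg h)
  one_mem' := fun _ _ h => h
  inv_mem' {f} hf := fun x y h => by
    have h1 : f (f.symm x) < f (f.symm y) := by
      rw [f.apply_symm_apply, f.apply_symm_apply]
      exact h
    exact hf.lt_iff_lt.1 h1

/-- The group of orientation-preserving real-analytic diffeomorphisms of the circle:
on the circle, preserving the orientation means having a lift to the universal cover
`t ↦ exp (i t)` that is an increasing bijection of `ℝ`. -/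
def DiffAnalyticCircle : Subgroup (Diffeomorph (𝓡 1) (𝓡 1) Circle Circle ω) where
  carrier := {f | ∃ F : ℝ ≃o ℝ, ∀ t : ℝ, f (Circle.exp t) = Circle.exp (F t)}
  mul_mem' := by
    rintro f g ⟨F, hF⟩ ⟨K, hK⟩
    refine ⟨K.trans F, fun t => ?_⟩
    change f (g (Circle.exp t)) = Circle.exp (F (K t))
    rw [hK, hF]
  one_mem' := ⟨OrderIso.refl ℝ, fun _ => rfl⟩
  inv_mem' := by
    rintro f ⟨F, hF⟩
    refine ⟨F.symm, fun t => ?_⟩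
    change f.symm (Circle.exp t) = Circle.exp (F.symm t)
    rw [← f.symm_apply_apply (Circle.exp (F.symm t)), hF, F.apply_symm_apply]

/-- A group embeds in another one if there is an injective homomorphism between them. -/
def EmbedsIn (Γ Δ : Type*) [Group Γ] [Group Δ] : Prop :=
  ∃ φ : Γ →* Δ, Function.Injective φ

/-! Obstruction. A nontrivial analytic diffeomorphism has finitely many fixed points. If `g`
commutes with `b` and fixes a point strictly between two consecutive fixed points of `b`, then it
fixes the whole infinite `b`-orbit of that point, so `g` is trivial. The centralizer of `b` thus
acts freely on such a gap and is commutative by Hölder's theorem (`OrderIso.mul_comm_of_central`).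
On the circle this is applied to lifts, after passing to powers that share a fixed point; if no
positive power of `b` has a fixed point, the lifts of its centralizer already act freely on the
line. A component that is not complete contains an induced path `u - v - w`. Both outer generators
commute with the middle one, while no positive powers `u ^ m` and `w ^ m` commute.

Construction. If all components are complete, the group is generated by commutative subgroups, one
per component. Weights independent over the rationals send each of them injectively into the real
line, realised as a hyperbolic flow. Each component gets its own conjugate of this flow, by an
analytic perturbation of the identity. A given reduced word moves a given base point for an open
dense set of conjugators (`exists_orbitPoint_fresh`), and the group is countable, so Baire's theorem
yields conjugators that work for all words (`exists_forall_orbitPoint_ne`). Everything takes place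
among lifts to the line that fix `0` and commute with translation by `2π`; these act both on the
interval `[0, 2π]` and on the circle, so a single representation serves both cases. -/

open scoped BoundedContinuousFunction

/-! ### Hölder's theorem and free actions on ordered sets -/

section Hoelder

/-- In an archimedean bi-ordered group every element lies between consecutive powers of a given
positive element. -/
theorem exists_zpow_le_lt_of_archimedean {G : Type*} [Group G] [LinearOrder G] [MulLeftMono G]
    [MulRightMono G] (arch : ∀ x y : G, 1 < y → ∃ n : ℕ, x < y ^ n) {d : G} (hd : 1 < d) (g : G) :
    ∃ n : ℤ, d ^ n ≤ g ∧ g < d ^ (n + 1) := by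
  have hmono : StrictMono fun n : ℤ => d ^ n := by
    refine strictMono_int_of_lt_succ fun n => ?_
    rw [zpow_add_one]
    exact lt_mul_of_one_lt_right' _ hd
  obtain ⟨k, hk⟩ := arch g d hd
  obtain ⟨l, hl⟩ := arch g⁻¹ d hd
  have hl' : d ^ (-(l : ℤ)) ≤ g := by
    rw [zpow_neg, zpow_natCast]
    exact (inv_lt_of_inv_lt' hl).le
  obtain ⟨n, hn, hmax⟩ := Int.exists_greatest_of_bdd (P := fun n : ℤ => d ^ n ≤ g)
    ⟨k, fun z hz => by
      by_contra! hzk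
      have := hmono hzk
      simp only [zpow_natCast] at this
      exact (hk.trans this).not_ge hz⟩ ⟨_, hl'⟩
  refine ⟨n, hn, ?_⟩
  by_contra! h
  have := hmax _ h
  omega

/-- **Hölder's theorem**: an archimedean bi-ordered group is commutative. -/
theorem mul_comm_of_archimedean {G : Type*} [Group G] [LinearOrder G] [MulLeftMono G]
    [MulRightMono G] (arch : ∀ x y : G, 1 < y → ∃ n : ℕ, x < y ^ n) (a c : G) :
    a * c = c * a := by
  -- With a least positive element the group is cyclic. Otherwise every `r > 1` dominates some `d *
  -- d` with `d > 1`, and for `r` the commutator this contradicts the bracketing of `a` and `c`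
  -- between powers of `d`.
  by_cases hmin : ∃ e : G, 1 < e ∧ ∀ g : G, 1 < g → e ≤ g
  · obtain ⟨e, he, hmin⟩ := hmin
    have key (g : G) : ∃ n : ℤ, g = e ^ n := by
      obtain ⟨n, h1, h2⟩ := exists_zpow_le_lt_of_archimedean arch he g
      refine ⟨n, ?_⟩
      by_contra hne
      have h3 : 1 < (e ^ n)⁻¹ * g := by
        rw [lt_inv_mul_iff_mul_lt, mul_one]
        exact lt_of_le_of_ne h1 (Ne.symm hne)
      have h4 := hmin _ h3
      rw [le_inv_mul_iff_mul_le, ← zpow_add_one] at h4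
      exact h2.not_ge h4
    obtain ⟨m, rfl⟩ := key a
    obtain ⟨n, rfl⟩ := key c
    exact zpow_mul_comm e m n
  · push Not at hmin
    have main (a c : G) : ¬ c * a < a * c := by
      intro hlt
      have hr : 1 < a * c * (c * a)⁻¹ := by
        rwa [lt_mul_inv_iff_mul_lt, one_mul]
      obtain ⟨d, hd, hdd⟩ : ∃ d : G, 1 < d ∧ d * d ≤ a * c * (c * a)⁻¹ := by
        generalize a * c * (c * a)⁻¹ = r at hr
        obtain ⟨f, hf, hfr⟩ := hmin r hr
        rcases le_total (f * f) r with h | h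
        · exact ⟨f, hf, h⟩
        -- If `f` is too large, its complement in `r` is small: `r ≤ f * f` says exactly that `f⁻¹ *
        -- r * f⁻¹ ≤ 1`.
        · refine ⟨f⁻¹ * r, by rwa [lt_inv_mul_iff_mul_lt, mul_one], ?_⟩
          rw [← mul_assoc]
          refine mul_le_of_le_one_left' ?_
          rw [mul_inv_le_iff_le_mul, one_mul, inv_mul_le_iff_le_mul]
          exact h
      obtain ⟨m, h1, h2⟩ := exists_zpow_le_lt_of_archimedean arch hd a
      obtain ⟨n, h3, h4⟩ := exists_zpow_le_lt_of_archimedean arch hd c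
      have h5 : a * c < d ^ (m + 1) * d ^ (n + 1) := mul_lt_mul_of_lt_of_le h2 h4.le
      have h6 : d ^ (m + 1) * d ^ (n + 1) = d * d * (d ^ n * d ^ m) := by
        simp only [← zpow_add, ← pow_two, ← zpow_natCast]
        congr 1
        push_cast
        ring
      have h7 : d * d * (d ^ n * d ^ m) ≤ a * c * (c * a)⁻¹ * (c * a) :=
        mul_le_mul' hdd (mul_le_mul' h3 h1)
      rw [inv_mul_cancel_right, ← h6] at h7
      exact h5.not_ge h7
    exact le_antisymm (not_lt.1 (main a c)) (not_lt.1 (main c a))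

variable {α : Type*} [ConditionallyCompleteLinearOrder α]

theorem OrderIso.pow_apply_eq_iterate {β : Type*} [LE β] (g : β ≃o β) (n : ℕ) (x : β) :
    (g ^ n) x = g^[n] x := by
  induction n generalizing x with
  | zero => rfl
  | succ n ih => rw [pow_succ, Function.iterate_succ_apply, ← ih]; rfl

/-- The orbit of a point moved up by an order automorphism leaves every interval without
fixed points. -/
theorem OrderIso.exists_lt_pow_apply {g : α ≃o α} {x y : α} (hx : x < g x)
    (hfix : ∀ z ∈ Set.Icc x y, g z ≠ z) : ∃ n : ℕ, y < (g ^ n) x := by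
  by_contra! h
  have hbdd : BddAbove (Set.range fun n : ℕ => (g ^ n) x) := ⟨y, by rintro _ ⟨n, rfl⟩; exact h n⟩
  have hle (n : ℕ) : (g ^ n) x ≤ sSup (Set.range fun n : ℕ => (g ^ n) x) :=
    le_csSup hbdd (Set.mem_range_self n)
  -- The supremum of a bounded orbit is a fixed point, because order automorphisms preserve suprema.
  refine hfix (sSup (Set.range fun n : ℕ => (g ^ n) x)) ⟨hle 0, csSup_le ⟨_, 0, rfl⟩ ?_⟩ ?_
  · rintro _ ⟨n, rfl⟩
    exact h n
  · rw [g.map_csSup' (Set.range_nonempty _) hbdd, ← Set.range_comp]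
    have hsucc (n : ℕ) : g ((g ^ n) x) = (g ^ (n + 1)) x := by rw [pow_succ']; rfl
    apply le_antisymm
    · refine csSup_le ⟨_, 0, rfl⟩ ?_
      rintro _ ⟨n, rfl⟩
      simp only [Function.comp, hsucc]
      exact hle _
    · refine csSup_le ⟨_, 0, rfl⟩ ?_
      rintro _ ⟨n, rfl⟩
      refine le_trans ?_ (le_csSup (a := g ((g ^ n) x)) ?_ (Set.mem_range_self n))
      · change (g ^ n) x ≤ g ((g ^ n) x)
        rw [hsucc, pow_succ]
        exact ((g ^ n).strictMono hx).le
      · refine ⟨y, ?_⟩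
        rintro _ ⟨n, rfl⟩
        simp only [Function.comp, hsucc]
        exact h _

theorem OrderIso.pow_apply_le {β : Type*} [Preorder β] {g : β ≃o β} {x : β} (h : g x ≤ x) (n : ℕ) :
    (g ^ n) x ≤ x := by
  induction n with
  | zero => exact le_rfl
  | succ n ih => rw [pow_succ]; exact ((g ^ n).monotone h).trans ih

/-- A group of order automorphisms acting freely on an invariant order-connected set is
commutative. -/
theorem OrderIso.mul_comm_of_free (S : Subgroup (α ≃o α)) (J : Set α) [hJ : J.OrdConnected]
    (hne : J.Nonempty) (hinv : ∀ g ∈ S, ∀ x ∈ J, g x ∈ J)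
    (hfree : ∀ g ∈ S, ∀ x ∈ J, g x = x → g = 1) {a c : α ≃o α} (ha : a ∈ S) (hc : c ∈ S) :
    a * c = c * a := by
  obtain ⟨o, ho⟩ := hne
  have arch (g : α ≃o α) (hg : g ∈ S) (x y : α) (hxJ : x ∈ J) (hyJ : y ∈ J) (hx : x < g x) :
      ∃ n : ℕ, y < (g ^ n) x := by
    refine OrderIso.exists_lt_pow_apply hx fun z hz hgz => ?_
    have := hfree g hg z (hJ.out hxJ hyJ hz) hgz
    rw [this] at hx
    exact lt_irrefl _ hx
  -- An element that moves one point of `J` up moves all of them up: a point not moved up would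
  -- block the orbit that has to pass it. This is what makes the order below right invariant.
  have pos (g : α ≃o α) (hg : g ∈ S) (x y : α) (hxJ : x ∈ J) (hyJ : y ∈ J) (hx : x < g x) :
      y < g y := by
    by_contra! hy
    have hgi : y ≤ g⁻¹ y := by
      have h := (g⁻¹).monotone hy
      rwa [show g⁻¹ (g y) = y from g.symm_apply_apply y] at h
    have hxi : g⁻¹ x ≤ x := by
      have h := (g⁻¹).monotone hx.le
      rwa [show g⁻¹ (g x) = x from g.symm_apply_apply x] at h
    rcases le_total x y with hxy | hxy
    · obtain ⟨n, hn⟩ := arch g hg x y hxJ hyJ hx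
      exact hn.not_ge (((g ^ n).monotone hxy).trans (OrderIso.pow_apply_le hy n))
    · rcases hgi.eq_or_lt with h | h
      · have h1 := hfree _ (S.inv_mem hg) y hyJ h.symm
        rw [inv_eq_one] at h1
        rw [h1] at hx
        exact lt_irrefl _ hx
      · obtain ⟨n, hn⟩ := arch g⁻¹ (S.inv_mem hg) y x hyJ hxJ h
        exact hn.not_ge (((g⁻¹ ^ n).monotone hxy).trans (OrderIso.pow_apply_le hxi n))
  -- Elements are compared by their values at `o`; freeness makes evaluation at `o` injective.
  let ord : LinearOrder S := LinearOrder.lift' (fun g : S => g.1 o) (by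
    intro f g hfg
    have hfg : f.1 o = g.1 o := hfg
    have h1 : (g⁻¹ * f).1 o = o := by
      change g.1.symm (f.1 o) = o
      rw [hfg, g.1.symm_apply_apply]
    have h2 := hfree _ (g⁻¹ * f).2 o ho h1
    exact (inv_mul_eq_one.1 (Subtype.ext h2 : g⁻¹ * f = 1)).symm)
  have lt_iff (f g : S) : f < g ↔ f.1 o < g.1 o := Iff.rfl
  have hleft : MulLeftStrictMono S := ⟨fun f g h hgh => f.1.strictMono hgh⟩
  have hright : MulRightStrictMono S := ⟨fun f g h hgh => by
    have h1 : o < (g⁻¹ * h).1 o := by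
      have := g.1.symm.strictMono ((lt_iff _ _).1 hgh)
      rwa [g.1.symm_apply_apply] at this
    have h2 := pos _ (g⁻¹ * h).2 o (f.1 o) ho (hinv _ f.2 _ ho) h1
    have h3 : g.1 (f.1 o) < g.1 (g.1.symm (h.1 (f.1 o))) := g.1.strictMono h2
    rwa [g.1.apply_symm_apply] at h3⟩
  have : MulLeftMono S := mulLeftMono_of_mulLeftStrictMono S
  have : MulRightMono S := mulRightMono_of_mulRightStrictMono S
  have h := mul_comm_of_archimedean (G := S) (fun x y hy => by
    obtain ⟨n, hn⟩ := arch y.1 y.2 o (x.1 o) ho (hinv _ x.2 _ ho) hy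
    exact ⟨n, hn⟩) ⟨a, ha⟩ ⟨c, hc⟩
  exact congrArg Subtype.val h

/-- The orbit of a point which is not fixed by an order automorphism is infinite. -/
theorem OrderIso.injective_pow_apply {β : Type*} [LinearOrder β] {g : β ≃o β} {x : β}
    (h : g x ≠ x) : Function.Injective fun n : ℕ => (g ^ n) x := by
  simp only [OrderIso.pow_apply_eq_iterate]
  rcases lt_or_gt_of_ne h with h | h
  · exact (g.strictMono.strictAnti_iterate_of_map_lt h).injective
  · exact (g.strictMono.strictMono_iterate_of_lt_map h).injective

/-- Let a group of order automorphisms fix the end points of an interval, and suppose that its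
nontrivial elements have finitely many fixed points there. If its center is nontrivial,
it is commutative. -/
theorem OrderIso.mul_comm_of_central [DenselyOrdered α] (S : Subgroup (α ≃o α)) {p p' : α}
    (hpp : p < p') (hp : ∀ g ∈ S, g p = p) (hp' : ∀ g ∈ S, g p' = p')
    (hfin : ∀ g ∈ S, {x ∈ Set.Icc p p' | g x = x}.Infinite → g = 1)
    {B : α ≃o α} (hB : B ∈ S) (hB1 : B ≠ 1) (hcomm : ∀ g ∈ S, g * B = B * g)
    {a c : α ≃o α} (ha : a ∈ S) (hc : c ∈ S) : a * c = c * a := by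
  have hF : {x ∈ Set.Ioc p p' | B x = x}.Finite := by
    by_contra h
    exact hB1 (hfin B hB (Set.Infinite.mono (fun x hx => ⟨Set.Ioc_subset_Icc_self hx.1, hx.2⟩) h))
  -- The first fixed point of `B` after `p`. Since `S` commutes with `B`, it permutes the fixed
  -- points of `B` and so fixes `q`.
  obtain ⟨q, ⟨⟨hpq, hqp⟩, hBq⟩, hmin⟩ :=
    Set.exists_min_image _ id hF ⟨p', ⟨hpp, le_rfl⟩, hp' B hB⟩
  have hle (g : α ≃o α) (hg : g ∈ S) : q ≤ g q := by
    refine hmin (g q) ⟨⟨?_, ?_⟩, ?_⟩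
    · have := g.strictMono hpq
      rwa [hp g hg] at this
    · have := g.monotone hqp
      rwa [hp' g hg] at this
    · have := DFunLike.congr_fun (hcomm g hg) q
      change g (B q) = B (g q) at this
      rw [← this, hBq]
  have hq (g : α ≃o α) (hg : g ∈ S) : g q = q := by
    refine le_antisymm ?_ (hle g hg)
    have := g.monotone (hle _ (S.inv_mem hg))
    rwa [show g (g⁻¹ q) = q from g.apply_symm_apply q] at this
  have hinv (g : α ≃o α) (hg : g ∈ S) (x : α) (hx : x ∈ Set.Ioo p q) : g x ∈ Set.Ioo p q := by
    refine ⟨?_, ?_⟩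
    · rw [← hp g hg]; exact g.strictMono hx.1
    · rw [← hq g hg]; exact g.strictMono hx.2
  refine OrderIso.mul_comm_of_free S (Set.Ioo p q) (Set.nonempty_Ioo.2 hpq) hinv ?_ ha hc
  intro g hg x hx hgx
  apply hfin g hg
  have hBx : B x ≠ x := fun h => hx.2.not_ge (hmin x ⟨⟨hx.1, hx.2.le.trans hqp⟩, h⟩)
  refine (Set.infinite_range_of_injective (OrderIso.injective_pow_apply hBx)).mono ?_
  rintro _ ⟨n, rfl⟩
  have h1 := hinv _ (S.pow_mem hB n) x hx
  refine ⟨⟨h1.1.le, h1.2.le.trans hqp⟩, ?_⟩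
  have h2 : Commute g (B ^ n) := Commute.pow_right (hcomm g hg) n
  have h3 := DFunLike.congr_fun h2.eq x
  change g ((B ^ n) x) = (B ^ n) (g x) at h3
  rw [hgx] at h3
  exact h3

end Hoelder

/-! ### Rigidity of analytic diffeomorphisms and their centralizers -/

section Obstruction

/-- Two analytic functions on the line which agree at infinitely many points of a compact
interval are equal. -/
theorem ContDiff.eq_of_infinite_eq {E : Type*} [NormedAddCommGroup E] [NormedSpace ℝ E]
    [CompleteSpace E] {f g : ℝ → E} (hf : ContDiff ℝ ω f) (hg : ContDiff ℝ ω g) {a b : ℝ}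
    (h : {x ∈ Set.Icc a b | f x = g x}.Infinite) : f = g := by
  obtain ⟨z, -, hz⟩ := h.exists_accPt_of_subset_isCompact isCompact_Icc (Set.sep_subset _ _)
  have hz' : ∃ᶠ x in nhdsWithin z {z}ᶜ, f x = g x :=
    (accPt_iff_frequently_nhdsNE.1 hz).mono fun x hx => hx.2
  exact (contDiff_omega_iff_analyticOnNhd.1 hf).eq_of_frequently_eq
    (contDiff_omega_iff_analyticOnNhd.1 hg) hz'

theorem contMDiff_projIcc_comp {f : ℝ → ℝ} (hf : ContDiff ℝ ω f)
    (hmem : ∀ x, f x ∈ Set.Icc (0 : ℝ) 1) :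
    ContMDiff 𝓘(ℝ, ℝ) (𝓡∂ 1) ω fun x => Set.projIcc (0 : ℝ) 1 zero_le_one (f x) := by
  have := (contMDiffOn_projIcc (x := 0) (y := 1) (n := ω)).comp_contMDiff hf.contMDiff hmem
  exact this

/-- An analytic diffeomorphism of the interval with infinitely many fixed points is trivial. -/
theorem Diffeomorph.eq_one_of_infinite_fixed_Icc
    (f : Diffeomorph (𝓡∂ 1) (𝓡∂ 1) (Set.Icc (0 : ℝ) 1) (Set.Icc (0 : ℝ) 1) ω)
    (h : {x | f x = x}.Infinite) : f = 1 := by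
  -- An analytic map of the whole line onto `[0, 1]`: pulling back along it allows the identity
  -- theorem to be used even when the fixed points accumulate at an end point.
  let c : ℝ → ℝ := fun s => (1 - Real.cos s) / 2
  have hc : ContDiff ℝ ω c := (contDiff_const.sub Real.contDiff_cos).div_const _
  have hcm (s : ℝ) : c s ∈ Set.Icc (0 : ℝ) 1 := by
    have h1 := Real.neg_one_le_cos s
    have h2 := Real.cos_le_one s
    constructor <;> simp only [c] <;> linarith
  let u : ℝ → Set.Icc (0 : ℝ) 1 := fun s => Set.projIcc 0 1 zero_le_one (c s)
  have hu : ContMDiff 𝓘(ℝ, ℝ) (𝓡∂ 1) ω u := contMDiff_projIcc_comp hc hcm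
  have huc (s : ℝ) : (u s : ℝ) = c s := by
    simp only [u, Set.projIcc_of_mem zero_le_one (hcm s)]
  have hF : ContDiff ℝ ω fun s => (f (u s) : ℝ) :=
    (contMDiff_subtypeVal_Icc.comp (f.contMDiff.comp hu)).contDiff
  have hsurj (x : Set.Icc (0 : ℝ) 1) : ∃ s ∈ Set.Icc 0 Real.pi, u s = x := by
    refine ⟨Real.arccos (1 - 2 * x), ⟨Real.arccos_nonneg _, Real.arccos_le_pi _⟩, ?_⟩
    apply Subtype.ext
    rw [huc]
    simp only [c]
    rw [Real.cos_arccos (by linarith [x.2.2]) (by linarith [x.2.1])]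
    ring
  have key : (fun s => (f (u s) : ℝ)) = c := by
    refine ContDiff.eq_of_infinite_eq hF hc (a := 0) (b := Real.pi) ?_
    refine Set.Infinite.of_image u (h.mono ?_)
    rintro x (hx : f x = x)
    obtain ⟨s, hs, rfl⟩ := hsurj x
    refine ⟨s, ⟨hs, ?_⟩, rfl⟩
    rw [← huc, hx]
  refine Diffeomorph.ext fun x => Subtype.ext ?_
  obtain ⟨s, -, rfl⟩ := hsurj x
  rw [show (f (u s) : ℝ) = c s from congrFun key s, ← huc]
  rfl

theorem contMDiff_coe_circle : ContMDiff (𝓡 1) 𝓘(ℝ, ℂ) ω fun z : Circle => (z : ℂ) := by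
  have := finrank_real_complex_fact'
  exact contMDiff_coe_sphere (E := ℂ) (n := 1)

theorem contDiff_coe_circle_comp_exp (f : Diffeomorph (𝓡 1) (𝓡 1) Circle Circle ω) :
    ContDiff ℝ ω fun t : ℝ => (f (Circle.exp t) : ℂ) := by
  exact (contMDiff_coe_circle.comp (f.contMDiff.comp contMDiff_circleExp)).contDiff

/-- An analytic diffeomorphism of the circle with infinitely many fixed points, counted on the
universal cover in a compact interval, is trivial. -/
theorem Diffeomorph.eq_one_of_infinite_fixed_exp
    (f : Diffeomorph (𝓡 1) (𝓡 1) Circle Circle ω) {a b : ℝ}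
    (h : {t ∈ Set.Icc a b | f (Circle.exp t) = Circle.exp t}.Infinite) : f = 1 := by
  have key := ContDiff.eq_of_infinite_eq (contDiff_coe_circle_comp_exp f)
    (contDiff_coe_circle_comp_exp (Diffeomorph.refl (𝓡 1) Circle ω)) (a := a) (b := b)
    (h.mono fun t ht => ⟨ht.1, congrArg Subtype.val ht.2⟩)
  refine Diffeomorph.ext fun z => ?_
  obtain ⟨t, rfl⟩ := Circle.exp_surjective z
  exact Subtype.ext (congrFun key t)

theorem Circle.exists_exp_eq_mem_Icc (z : Circle) :
    ∃ t ∈ Set.Icc (-Real.pi) Real.pi, Circle.exp t = z :=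
  ⟨Complex.arg z, ⟨(Complex.neg_pi_lt_arg _).le, Complex.arg_le_pi _⟩, Circle.exp_arg z⟩

theorem Diffeomorph.eq_one_of_infinite_fixed_circle
    (f : Diffeomorph (𝓡 1) (𝓡 1) Circle Circle ω) (h : {z | f z = z}.Infinite) : f = 1 := by
  refine f.eq_one_of_infinite_fixed_exp (a := -Real.pi) (b := Real.pi) ?_
  refine Set.Infinite.of_image Circle.exp (h.mono ?_)
  rintro z (hz : f z = z)
  obtain ⟨t, ht, rfl⟩ := Circle.exists_exp_eq_mem_Icc z
  exact ⟨t, ⟨ht, hz⟩, rfl⟩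

namespace DiffAnalyticInterval

/-- The order automorphism of the interval underlying an increasing diffeomorphism. -/
noncomputable def toOrderIso : DiffAnalyticInterval →* (Set.Icc (0 : ℝ) 1 ≃o Set.Icc (0 : ℝ) 1) where
  toFun f := StrictMono.orderIsoOfRightInverse f.1 f.2 f.1.symm f.1.apply_symm_apply
  map_one' := rfl
  map_mul' _ _ := rfl

theorem eq_of_toOrderIso_eq {f g : DiffAnalyticInterval} (h : toOrderIso f = toOrderIso g) :
    f = g :=
  Subtype.ext (Diffeomorph.ext fun x => DFunLike.congr_fun h x)

/-- Commutation is transitive on nontrivial elements. -/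
theorem mul_comm_of_commute {a b c : DiffAnalyticInterval} (hb : b ≠ 1) (hab : Commute a b)
    (hcb : Commute c b) : a * c = c * a := by
  apply eq_of_toOrderIso_eq
  rw [map_mul, map_mul]
  refine OrderIso.mul_comm_of_central ((Subgroup.centralizer {b}).map toOrderIso)
    (p := ⊥) (p' := ⊤) bot_lt_top (fun g _ => g.map_bot) (fun g _ => g.map_top) ?_
    (B := toOrderIso b) ⟨b, Subgroup.mem_centralizer_singleton_iff.2 rfl, rfl⟩ ?_ ?_
    ⟨a, Subgroup.mem_centralizer_singleton_iff.2 hab.eq, rfl⟩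
    ⟨c, Subgroup.mem_centralizer_singleton_iff.2 hcb.eq, rfl⟩
  · rintro _ ⟨g, -, rfl⟩ hg
    have : g = 1 := Subtype.ext (g.1.eq_one_of_infinite_fixed_Icc (hg.mono fun x hx => hx.2))
    rw [this, map_one]
  · exact fun h => hb (eq_of_toOrderIso_eq (h.trans (map_one _).symm))
  · rintro _ ⟨g, hg, rfl⟩
    rw [← map_mul, ← map_mul, Subgroup.mem_centralizer_singleton_iff.1 hg]

end DiffAnalyticInterval

namespace DiffAnalyticCircle

/-- `F` is a lift of the circle map `f` to the universal cover. -/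
def IsLift (f : DiffAnalyticCircle) (F : ℝ ≃o ℝ) : Prop :=
  ∀ t : ℝ, f.1 (Circle.exp t) = Circle.exp (F t)

theorem IsLift.one : IsLift 1 1 := fun _ => rfl

theorem IsLift.mul {f g : DiffAnalyticCircle} {F K : ℝ ≃o ℝ} (hf : IsLift f F) (hg : IsLift g K) :
    IsLift (f * g) (F * K) := fun t => by
  change f.1 (g.1 (Circle.exp t)) = Circle.exp (F (K t))
  rw [hg t, hf]

theorem IsLift.inv {f : DiffAnalyticCircle} {F : ℝ ≃o ℝ} (hf : IsLift f F) :
    IsLift f⁻¹ F⁻¹ := fun t => by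
  change f.1.symm (Circle.exp t) = Circle.exp (F.symm t)
  rw [← f.1.symm_apply_apply (Circle.exp (F.symm t)), hf, F.apply_symm_apply]

theorem IsLift.eq_of_eq {f g : DiffAnalyticCircle} {F : ℝ ≃o ℝ} (hf : IsLift f F)
    (hg : IsLift g F) : f = g :=
  Subtype.ext (Diffeomorph.ext fun z => by
    obtain ⟨t, rfl⟩ := Circle.exp_surjective z
    rw [hf t, hg t])

/-- A lift of the identity with a fixed point is the identity. -/
theorem IsLift.eq_one {F : ℝ ≃o ℝ} (hF : IsLift 1 F) {x : ℝ} (hx : F x = x) : F = 1 := by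
  -- The displacement is continuous with values in a discrete set, hence constant.
  have hmem (t : ℝ) : F t - t ∈ (AddSubgroup.zmultiples (2 * Real.pi) : Set ℝ) := by
    obtain ⟨n, hn⟩ := Circle.exp_eq_exp.1 (hF t).symm
    exact ⟨n, by simp only [hn]; simp⟩
  have hdisc : IsDiscrete (AddSubgroup.zmultiples (2 * Real.pi) : Set ℝ) :=
    ⟨inferInstanceAs (DiscreteTopology (AddSubgroup.zmultiples (2 * Real.pi)))⟩
  ext t
  have := isPreconnected_univ.constant_of_mapsTo hdisc
    (f := fun t => F t - t) (F.continuous.sub continuous_id).continuousOn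
    (fun t _ => hmem t) (Set.mem_univ t) (Set.mem_univ x)
  simp only [hx, sub_self] at this
  exact sub_eq_zero.1 this

/-- A circle diffeomorphism with a fixed point has a lift with a fixed point. -/
theorem exists_isLift_fixed {f : DiffAnalyticCircle} {p : ℝ}
    (hp : f.1 (Circle.exp p) = Circle.exp p) : ∃ F : ℝ ≃o ℝ, IsLift f F ∧ F p = p := by
  obtain ⟨F, hF⟩ := f.2
  refine ⟨F.trans (OrderIso.addRight (p - F p)), fun t => ?_, by simp⟩
  have h1 : Circle.exp (p - F p) = 1 := by
    rw [Circle.exp_sub, ← hF, hp, div_self']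
  change f.1 (Circle.exp t) = Circle.exp (F t + (p - F p))
  rw [Circle.exp_add, h1, mul_one, hF]

/-- A lift which fixes a point fixes its translates by the period. -/
theorem IsLift.apply_add_two_pi {f : DiffAnalyticCircle} {F : ℝ ≃o ℝ} (hF : IsLift f F) {p : ℝ}
    (hp : F p = p) : F (p + 2 * Real.pi) = p + 2 * Real.pi := by
  -- The image of `p + 2π` is a translate of `p` by a positive multiple of the period, so it is at
  -- least `p + 2π`; the same bound for the inverse gives equality.
  have aux {f : DiffAnalyticCircle} {F : ℝ ≃o ℝ} (hF : IsLift f F) (hp : F p = p) :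
      p + 2 * Real.pi ≤ F (p + 2 * Real.pi) := by
    have h1 : Circle.exp (F (p + 2 * Real.pi)) = Circle.exp p := by
      rw [← hF, Circle.exp_add, Circle.exp_two_pi, mul_one, hF, hp]
    obtain ⟨n, hn⟩ := Circle.exp_eq_exp.1 h1
    have h2 : p < F (p + 2 * Real.pi) := by
      conv_lhs => rw [← hp]
      exact F.strictMono (by linarith [Real.pi_pos])
    rw [hn] at h2 ⊢
    have h3 : (0 : ℝ) < n := by
      by_contra! h
      nlinarith [Real.pi_pos]
    have h4 : (1 : ℝ) ≤ n := by exact_mod_cast (show (0 : ℤ) < n by exact_mod_cast h3)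
    nlinarith [Real.pi_pos]
  have hp' : F⁻¹ p = p := by
    conv_lhs => rw [← hp]
    exact F.symm_apply_apply p
  refine le_antisymm ?_ (aux hF hp)
  have := F.monotone (aux hF.inv hp')
  rwa [show F (F⁻¹ (p + 2 * Real.pi)) = _ from F.apply_symm_apply _] at this

/-- Commutation with a nontrivial element with a fixed point, among elements sharing this fixed
point. -/
theorem mul_comm_of_fixed {a b c : DiffAnalyticCircle} {z : Circle} (hb : b ≠ 1)
    (ha' : a.1 z = z) (hb' : b.1 z = z) (hc' : c.1 z = z) (hab : Commute a b) (hcb : Commute c b) :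
    a * c = c * a := by
  obtain ⟨p, rfl⟩ := Circle.exp_surjective z
  obtain ⟨A, hA, hAp⟩ := exists_isLift_fixed ha'
  obtain ⟨B, hB, hBp⟩ := exists_isLift_fixed hb'
  obtain ⟨C, hC, hCp⟩ := exists_isLift_fixed hc'
  let S : Subgroup (ℝ ≃o ℝ) :=
    { carrier := {F | F p = p ∧ ∃ f : DiffAnalyticCircle, Commute f b ∧ IsLift f F}
      mul_mem' := by
        rintro F K ⟨hF, f, hfb, hfF⟩ ⟨hK, k, hkb, hkK⟩
        refine ⟨?_, f * k, hfb.mul_left hkb, hfF.mul hkK⟩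
        change F (K p) = p
        rw [hK, hF]
      one_mem' := ⟨rfl, 1, Commute.one_left b, IsLift.one⟩
      inv_mem' := by
        rintro F ⟨hF, f, hfb, hfF⟩
        refine ⟨?_, f⁻¹, hfb.inv_left, hfF.inv⟩
        conv_lhs => rw [← hF]
        exact F.symm_apply_apply p }
  have hAC : A * C = C * A := by
    refine OrderIso.mul_comm_of_central S (p := p) (p' := p + 2 * Real.pi)
      (by linarith [Real.pi_pos]) (fun g hg => hg.1) ?_ ?_ (B := B) ⟨hBp, b, Commute.refl b, hB⟩
      ?_ ?_ ⟨hAp, a, hab, hA⟩ ⟨hCp, c, hcb, hC⟩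
    · rintro F ⟨hF, f, hfb, hfF⟩
      exact hfF.apply_add_two_pi hF
    · rintro F ⟨hF, f, hfb, hfF⟩ hinf
      have hf1 : f = 1 := Subtype.ext (f.1.eq_one_of_infinite_fixed_exp
        (hinf.mono fun t ht => ⟨ht.1, by rw [hfF t, ht.2]⟩))
      rw [hf1] at hfF
      exact hfF.eq_one hF
    · rintro rfl
      exact hb (hB.eq_of_eq IsLift.one)
    · rintro F ⟨hF, f, hfb, hfF⟩
      -- The commutator of the two lifts covers the identity and fixes `p`, so it is trivial.
      have h1 := (hfF.mul hB).mul (hB.mul hfF).inv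
      rw [hfb.eq, mul_inv_cancel] at h1
      have h2 := h1.eq_one (x := p) (by
        change F (B ((B * F).symm p)) = p
        have h3 : (B * F).symm p = p := by
          rw [OrderIso.symm_apply_eq]
          change p = B (F p)
          rw [hF, hBp]
        rw [h3, hBp, hF])
      exact mul_inv_eq_one.1 h2
  have h := hA.mul hC
  rw [hAC] at h
  exact h.eq_of_eq (hC.mul hA)

theorem pow_apply_eq_iterate (f : DiffAnalyticCircle) (n : ℕ) (z : Circle) :
    (f ^ n).1 z = f.1^[n] z := by
  induction n generalizing z with
  | zero => rfl
  | succ n ih => rw [pow_succ, Function.iterate_succ_apply, ← ih]; rfl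

/-- If no positive power of `b` has a fixed point, the centralizer of `b` is commutative. -/
theorem mul_comm_of_not_fixed {a b c : DiffAnalyticCircle}
    (hb : ∀ k : ℕ, 0 < k → ∀ z, (b ^ k).1 z ≠ z) (hab : Commute a b) (hcb : Commute c b) :
    a * c = c * a := by
  obtain ⟨A, hA⟩ := a.2
  obtain ⟨C, hC⟩ := c.2
  let S : Subgroup (ℝ ≃o ℝ) :=
    { carrier := {F | ∃ f : DiffAnalyticCircle, Commute f b ∧ IsLift f F}
      mul_mem' := by
        rintro F K ⟨f, hfb, hfF⟩ ⟨k, hkb, hkK⟩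
        exact ⟨f * k, hfb.mul_left hkb, hfF.mul hkK⟩
      one_mem' := ⟨1, Commute.one_left b, IsLift.one⟩
      inv_mem' := by
        rintro F ⟨f, hfb, hfF⟩
        exact ⟨f⁻¹, hfb.inv_left, hfF.inv⟩ }
  have hAC : A * C = C * A := by
    refine OrderIso.mul_comm_of_free S Set.univ Set.univ_nonempty (fun _ _ _ _ => Set.mem_univ _)
      ?_ ⟨a, hab, hA⟩ ⟨c, hcb, hC⟩
    rintro F ⟨f, hfb, hfF⟩ x - hFx
    have hfx : f.1 (Circle.exp x) = Circle.exp x := by rw [hfF x, hFx]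
    -- As no positive power of `b` has a fixed point, the `b`-orbit is infinite; it consists of
    -- fixed points of `f`.
    have hinj : Function.Injective fun n : ℕ => (b ^ n).1 (Circle.exp x) := by
      have hlt (m n : ℕ) (hmn : m < n) : (b ^ m).1 (Circle.exp x) ≠ (b ^ n).1 (Circle.exp x) := by
        intro heq
        refine hb (n - m) (by omega) (Circle.exp x) ?_
        apply (b ^ m).1.injective
        change (b ^ m * b ^ (n - m)).1 _ = _
        rw [← pow_add, Nat.add_sub_cancel' hmn.le]
        exact heq.symm
      intro m n hmn
      by_contra hne
      rcases lt_or_gt_of_ne hne with h | h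
      · exact hlt m n h hmn
      · exact hlt n m h hmn.symm
    have hf1 : f = 1 := by
      refine Subtype.ext (f.1.eq_one_of_infinite_fixed_circle
        ((Set.infinite_range_of_injective hinj).mono ?_))
      rintro _ ⟨n, rfl⟩
      have h := congrArg (fun k : DiffAnalyticCircle => k.1 (Circle.exp x)) (hfb.pow_right n).eq
      change f.1 ((b ^ n).1 _) = (b ^ n).1 (f.1 _) at h
      rw [hfx] at h
      exact h
    rw [hf1] at hfF
    exact hfF.eq_one hFx
  have h := IsLift.mul (f := a) (g := c) hA hC
  rw [hAC] at h
  exact h.eq_of_eq (IsLift.mul (f := c) (g := a) hC hA)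

/-- Suitable powers of elements of the centralizer of an element of infinite order commute. -/
theorem exists_pow_mul_comm {a b c : DiffAnalyticCircle} (hb : ∀ k : ℕ, 0 < k → b ^ k ≠ 1)
    (hab : Commute a b) (hcb : Commute c b) :
    ∃ m : ℕ, 0 < m ∧ a ^ m * c ^ m = c ^ m * a ^ m := by
  by_cases h : ∃ k : ℕ, 0 < k ∧ ∃ z, (b ^ k).1 z = z
  · obtain ⟨k, hk, z, hz⟩ := h
    have hfin : {z | (b ^ k).1 z = z}.Finite := by
      by_contra hinf
      exact hb k hk (Subtype.ext ((b ^ k).1.eq_one_of_infinite_fixed_circle hinf))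
    -- The centralizer preserves the finite set of fixed points of `b ^ k`, so by the pigeonhole
    -- principle some power of `f` fixes `z`.
    have key {f : DiffAnalyticCircle} (hf : Commute f b) : ∃ n : ℕ, 0 < n ∧ (f ^ n).1 z = z := by
      have hmaps (n : ℕ) : (f ^ n).1 z ∈ {z | (b ^ k).1 z = z} := by
        have h := congrArg (fun k : DiffAnalyticCircle => k.1 z) (hf.pow_pow n k).eq
        change (f ^ n).1 ((b ^ k).1 z) = (b ^ k).1 ((f ^ n).1 z) at h
        rw [hz] at h
        exact h.symm
      obtain ⟨m, n, hmn, heq⟩ := hfin.exists_lt_map_eq_of_forall_mem hmaps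
      refine ⟨n - m, by omega, ?_⟩
      apply (f ^ m).1.injective
      change (f ^ m * f ^ (n - m)).1 _ = _
      rw [← pow_add, Nat.add_sub_cancel' hmn.le]
      exact heq.symm
    obtain ⟨m, hm, ham⟩ := key hab
    obtain ⟨n, hn, hcn⟩ := key hcb
    refine ⟨m * n, Nat.mul_pos hm hn, mul_comm_of_fixed (b := b ^ k) (z := z) (hb k hk) ?_ hz ?_
      (hab.pow_pow _ _) (hcb.pow_pow _ _)⟩
    · rw [pow_mul, pow_apply_eq_iterate]
      exact Function.iterate_fixed ham n
    · rw [mul_comm, pow_mul, pow_apply_eq_iterate]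
      exact Function.iterate_fixed hcn m
  · push Not at h
    refine ⟨1, one_pos, ?_⟩
    rw [pow_one, pow_one]
    exact mul_comm_of_not_fixed h hab hcb

end DiffAnalyticCircle

end Obstruction

/-! ### Right-angled Artin groups and graphs without induced paths -/

section RAAG

variable {V : Type*}

/-- The generator of a right-angled Artin group attached to a vertex. -/
def RAAG.of (G : SimpleGraph V) (v : V) : RAAG G := PresentedGroup.of v

theorem RAAG.of_mul_comm {G : SimpleGraph V} {u v : V} (h : G.Adj u v) :
    RAAG.of G u * RAAG.of G v = RAAG.of G v * RAAG.of G u := by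
  have h1 : RAAG.of G u * RAAG.of G v * (RAAG.of G u)⁻¹ * (RAAG.of G v)⁻¹ = 1 :=
    PresentedGroup.one_of_mem (rels := {r : FreeGroup V | ∃ u v : V, G.Adj u v ∧
      r = FreeGroup.of u * FreeGroup.of v * (FreeGroup.of u)⁻¹ * (FreeGroup.of v)⁻¹})
      ⟨u, v, h, rfl⟩
  rwa [mul_inv_eq_one, mul_inv_eq_iff_eq_mul] at h1

/-- The universal property of a right-angled Artin group. -/
def RAAG.lift {G : SimpleGraph V} {H : Type*} [Group H] (f : V → H)
    (hf : ∀ u v, G.Adj u v → f u * f v = f v * f u) : RAAG G →* H :=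
  PresentedGroup.toGroup (f := f) (by
    rintro _ ⟨u, v, h, rfl⟩
    simp only [map_mul, map_inv, FreeGroup.lift_apply_of]
    rw [mul_inv_eq_one, mul_inv_eq_iff_eq_mul, hf u v h])

theorem RAAG.lift_of {G : SimpleGraph V} {H : Type*} [Group H] (f : V → H)
    (hf : ∀ u v, G.Adj u v → f u * f v = f v * f u) (v : V) : RAAG.lift f hf (RAAG.of G v) = f v :=
  PresentedGroup.toGroup.of _

theorem RAAG.closure_range_of (G : SimpleGraph V) :
    Subgroup.closure (Set.range (RAAG.of G)) = ⊤ :=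
  PresentedGroup.closure_range_of _

instance RAAG.instCountable [Countable V] (G : SimpleGraph V) : Countable (RAAG G) :=
  (PresentedGroup.mk_surjective _).countable

/-- The exponent sum, which sends every generator to `1` in the integers, detects these powers. -/
theorem RAAG.of_pow_ne_one (G : SimpleGraph V) (v : V) {k : ℕ} (hk : 0 < k) :
    RAAG.of G v ^ k ≠ 1 := by
  intro h
  have h1 := congrArg (RAAG.lift (G := G) (H := Multiplicative ℤ)
    (fun _ : V => Multiplicative.ofAdd (1 : ℤ)) (fun _ _ _ => rfl)) h
  rw [map_pow, RAAG.lift_of, MonoidHom.map_one, ← ofAdd_nsmul, ofAdd_eq_one] at h1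
  simp at h1
  omega

/-- Powers of generators at two different vertices which are not adjacent do not commute. -/
theorem RAAG.of_pow_mul_of_pow_ne {G : SimpleGraph V} {u w : V} (huw : u ≠ w) (hadj : ¬ G.Adj u w)
    {m : ℕ} (hm : 0 < m) :
    RAAG.of G u ^ m * RAAG.of G w ^ m ≠ RAAG.of G w ^ m * RAAG.of G u ^ m := by
  classical
  intro h
  -- Translation and doubling represent `u` and `w`, all other vertices act trivially; the relations
  -- hold as `u` and `w` are not adjacent. The two products send `0` to `m` and to `m * 2 ^ m`.
  let s : Equiv.Perm ℚ := Equiv.addRight 1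
  let t : Equiv.Perm ℚ := Equiv.mulRight₀ 2 two_ne_zero
  let f : V → Equiv.Perm ℚ := fun v => if v = u then s else if v = w then t else 1
  have hf (p q : V) (hpq : G.Adj p q) : f p * f q = f q * f p := by
    simp only [f]
    by_cases h1 : p = u
    · subst h1
      have h2 : q ≠ w := by rintro rfl; exact hadj hpq
      have h3 : q ≠ p := hpq.ne'
      simp [h2, h3]
    · by_cases h2 : p = w
      · subst h2
        have h2 : q ≠ u := by rintro rfl; exact hadj hpq.symm
        have h3 : q ≠ p := hpq.ne'
        simp [h2, h3]
      · simp [h1, h2]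
  have hs (n : ℕ) (x : ℚ) : (s ^ n) x = x + n := by
    induction n generalizing x with
    | zero => simp
    | succ n ih =>
      rw [pow_succ, Equiv.Perm.mul_apply, ih]
      simp only [s, Equiv.coe_addRight]
      push_cast
      ring
  have ht (n : ℕ) (x : ℚ) : (t ^ n) x = x * 2 ^ n := by
    induction n generalizing x with
    | zero => simp
    | succ n ih =>
      rw [pow_succ, Equiv.Perm.mul_apply, ih]
      change x * 2 * 2 ^ n = x * 2 ^ (n + 1)
      ring
  have h1 := congrArg (fun g => RAAG.lift (G := G) f hf g 0) h
  have hu : f u = s := by simp [f]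
  have hw : f w = t := by simp [f, huw.symm]
  simp only [map_mul, map_pow, RAAG.lift_of, hu, hw, Equiv.Perm.mul_apply, hs, ht] at h1
  have h2 : (2 : ℚ) ≤ 2 ^ m := by
    calc (2 : ℚ) = 2 ^ 1 := by norm_num
      _ ≤ 2 ^ m := pow_le_pow_right₀ (by norm_num) hm
  have h3 : (0 : ℚ) < m := by exact_mod_cast hm
  nlinarith

/-- A graph without induced paths on three vertices is a disjoint union of complete graphs. -/
theorem SimpleGraph.toSimpleGraph_eq_top_of_forall {G : SimpleGraph V}
    (h : ∀ u v w, G.Adj u v → G.Adj v w → u ≠ w → G.Adj u w) (C : G.ConnectedComponent) :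
    C.toSimpleGraph = ⊤ := by
  ext ⟨x, hx⟩ ⟨y, hy⟩
  have hreach : G.Reachable x y := SimpleGraph.ConnectedComponent.exact (hx.trans hy.symm)
  constructor
  · intro hadj
    exact hadj.ne
  · intro hne
    have hne : x ≠ y := fun h => hne (Subtype.ext h)
    change G.Adj x y
    -- A shortest walk of length at least two contains an induced path on three vertices.
    obtain ⟨p, hp⟩ := hreach.exists_walk_length_eq_dist
    by_contra hxy
    have hd : 1 < G.dist x y := by
      have h0 : G.dist x y ≠ 0 := fun h0 => hne (hreach.dist_eq_zero_iff.1 h0)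
      have h1 : G.dist x y ≠ 1 := fun h1 => hxy (SimpleGraph.dist_eq_one_iff_adj.1 h1)
      omega
    obtain ⟨a, b, c, hab, hbc, hac, hne⟩ := p.exists_adj_adj_not_adj_ne hp hd
    exact hac (h a b c hab hbc hne)

theorem SimpleGraph.adj_of_toSimpleGraph_eq_top {G : SimpleGraph V}
    (h : ∀ C : G.ConnectedComponent, C.toSimpleGraph = ⊤) {u v : V} (huv : u ≠ v)
    (hC : G.connectedComponentMk u = G.connectedComponentMk v) : G.Adj u v := by
  have h1 : (G.connectedComponentMk v).toSimpleGraph.Adj ⟨u, hC⟩ ⟨v, rfl⟩ := by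
    rw [h]
    exact fun h => huv (congrArg Subtype.val h)
  exact h1

theorem toSimpleGraph_eq_top_of_embedsIn_interval {G : SimpleGraph V}
    (h : EmbedsIn (RAAG G) DiffAnalyticInterval) (C : G.ConnectedComponent) :
    C.toSimpleGraph = ⊤ := by
  obtain ⟨φ, hφ⟩ := h
  refine SimpleGraph.toSimpleGraph_eq_top_of_forall (fun u v w huv hvw huw => ?_) C
  by_contra hadj
  refine RAAG.of_pow_mul_of_pow_ne huw hadj one_pos (hφ ?_)
  simp only [pow_one, map_mul]
  refine DiffAnalyticInterval.mul_comm_of_commute (b := φ (RAAG.of G v)) ?_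
    (Commute.map (RAAG.of_mul_comm huv) φ) (Commute.map (RAAG.of_mul_comm hvw.symm) φ)
  intro h1
  refine RAAG.of_pow_ne_one G v one_pos (hφ ?_)
  rw [pow_one, h1, map_one]

/-- Commutation is only transitive up to powers on the circle, which suffices because equal powers
of non-adjacent generators do not commute either. -/
theorem toSimpleGraph_eq_top_of_embedsIn_circle {G : SimpleGraph V}
    (h : EmbedsIn (RAAG G) DiffAnalyticCircle) (C : G.ConnectedComponent) :
    C.toSimpleGraph = ⊤ := by
  obtain ⟨φ, hφ⟩ := h
  refine SimpleGraph.toSimpleGraph_eq_top_of_forall (fun u v w huv hvw huw => ?_) C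
  by_contra hadj
  obtain ⟨m, hm, hcomm⟩ := DiffAnalyticCircle.exists_pow_mul_comm (b := φ (RAAG.of G v))
    (fun k hk h1 => RAAG.of_pow_ne_one G v hk (hφ (by rw [map_pow, h1, map_one])))
    (Commute.map (RAAG.of_mul_comm huv) φ) (Commute.map (RAAG.of_mul_comm hvw.symm) φ)
  refine RAAG.of_pow_mul_of_pow_ne huw hadj hm (hφ ?_)
  simp only [map_mul, map_pow]
  exact hcomm

end RAAG

/-! ### Periodic analytic lifts and their actions on the interval and the circle -/

section AnalyticLift

/-- The group of analytic diffeomorphisms of the line which commute with the translation by the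
period `2π` and fix the origin. -/
def AnalyticLift : Subgroup (ℝ ≃o ℝ) where
  carrier := {F | ContDiff ℝ ω F ∧ ContDiff ℝ ω F.symm ∧
    (∀ x, F (x + 2 * Real.pi) = F x + 2 * Real.pi) ∧ F 0 = 0}
  mul_mem' := by
    rintro F K ⟨hF, hF', hFp, hF0⟩ ⟨hK, hK', hKp, hK0⟩
    refine ⟨hF.comp hK, hK'.comp hF', fun x => ?_, ?_⟩
    · change F (K (x + 2 * Real.pi)) = F (K x) + 2 * Real.pi
      rw [hKp, hFp]
    · change F (K 0) = 0
      rw [hK0, hF0]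
  one_mem' := ⟨contDiff_id, contDiff_id, fun _ => rfl, rfl⟩
  inv_mem' := by
    rintro F ⟨hF, hF', hFp, hF0⟩
    refine ⟨hF', hF, fun x => ?_, ?_⟩
    · change F.symm (x + 2 * Real.pi) = F.symm x + 2 * Real.pi
      rw [OrderIso.symm_apply_eq, hFp, F.apply_symm_apply]
    · change F.symm 0 = 0
      rw [OrderIso.symm_apply_eq, hF0]

namespace AnalyticLift

theorem apply_zero (F : AnalyticLift) : F.1 0 = 0 := F.2.2.2.2

theorem apply_add_two_pi (F : AnalyticLift) (x : ℝ) :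
    F.1 (x + 2 * Real.pi) = F.1 x + 2 * Real.pi := F.2.2.2.1 x

theorem contDiff (F : AnalyticLift) : ContDiff ℝ ω F.1 := F.2.1

theorem apply_two_pi (F : AnalyticLift) : F.1 (2 * Real.pi) = 2 * Real.pi := by
  have := apply_add_two_pi F 0
  rwa [zero_add, apply_zero F, zero_add] at this

theorem apply_add_int_mul (F : AnalyticLift) (n : ℤ) (x : ℝ) :
    F.1 (x + n * (2 * Real.pi)) = F.1 x + n * (2 * Real.pi) := by
  induction n using Int.induction_on with
  | zero => simp
  | succ n ih =>
    have := apply_add_two_pi F (x + (n : ℤ) * (2 * Real.pi))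
    push_cast at *
    rw [add_mul, one_mul, ← add_assoc, this, ih, add_assoc]
  | pred n ih =>
    have := apply_add_two_pi F (x + (-(n : ℤ) - 1 : ℤ) * (2 * Real.pi))
    push_cast at *
    rw [show x + (-(n : ℝ) - 1) * (2 * Real.pi) + 2 * Real.pi = x + -n * (2 * Real.pi) by ring,
      ih] at this
    linarith

/-- Restriction to a period, rescaled to the unit interval. -/
noncomputable def restrict (F : AnalyticLift) (x : Set.Icc (0 : ℝ) 1) : Set.Icc (0 : ℝ) 1 :=
  ⟨F.1 (2 * Real.pi * x) / (2 * Real.pi), by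
    have h0 : F.1 0 ≤ F.1 (2 * Real.pi * x) := F.1.monotone (mul_nonneg Real.two_pi_pos.le x.2.1)
    have h1 : F.1 (2 * Real.pi * x) ≤ F.1 (2 * Real.pi) :=
      F.1.monotone (mul_le_of_le_one_right Real.two_pi_pos.le x.2.2)
    rw [apply_zero F] at h0
    rw [apply_two_pi F] at h1
    exact ⟨div_nonneg h0 Real.two_pi_pos.le, (div_le_one Real.two_pi_pos).2 h1⟩⟩

theorem restrict_mul (F K : AnalyticLift) (x : Set.Icc (0 : ℝ) 1) :
    restrict (F * K) x = restrict F (restrict K x) := by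
  apply Subtype.ext
  change F.1 (K.1 _) / _ = F.1 (2 * Real.pi * (K.1 _ / (2 * Real.pi))) / _
  rw [mul_div_cancel₀ _ Real.two_pi_pos.ne']

theorem restrict_one (x : Set.Icc (0 : ℝ) 1) : restrict 1 x = x := by
  apply Subtype.ext
  change 2 * Real.pi * x / (2 * Real.pi) = x
  rw [mul_div_cancel_left₀ _ Real.two_pi_pos.ne']

theorem contMDiff_restrict (F : AnalyticLift) : ContMDiff (𝓡∂ 1) (𝓡∂ 1) ω (restrict F) := by
  have h : ContDiff ℝ ω fun x : ℝ => F.1 (2 * Real.pi * x) / (2 * Real.pi) :=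
    ((contDiff F).comp (contDiff_const.mul contDiff_id)).div_const _
  rw [contMDiff_iff_comp_subtypeVal_Icc]
  refine ⟨?_, h.contMDiff.comp contMDiff_subtypeVal_Icc⟩
  exact Continuous.subtype_mk (h.continuous.comp continuous_subtype_val) _

theorem strictMono_restrict (F : AnalyticLift) : StrictMono (restrict F) := fun x y hxy => by
  have h : (x : ℝ) < y := hxy
  change F.1 _ / (2 * Real.pi) < F.1 _ / (2 * Real.pi)
  have := F.1.strictMono (mul_lt_mul_of_pos_left h Real.two_pi_pos)
  exact div_lt_div_of_pos_right this Real.two_pi_pos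

/-- The diffeomorphism of the interval given by restriction to a period. -/
noncomputable def toInterval : AnalyticLift →* DiffAnalyticInterval where
  toFun F :=
    ⟨{ toFun := restrict F
       invFun := restrict F⁻¹
       left_inv := fun x => by rw [← restrict_mul, inv_mul_cancel, restrict_one]
       right_inv := fun x => by rw [← restrict_mul, mul_inv_cancel, restrict_one]
       contMDiff_toFun := contMDiff_restrict F
       contMDiff_invFun := contMDiff_restrict F⁻¹ }, strictMono_restrict F⟩
  map_one' := Subtype.ext (Diffeomorph.ext restrict_one)
  map_mul' F K := Subtype.ext (Diffeomorph.ext (restrict_mul F K))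

/-- Lifts in the kernel of the restriction to the interval fix the points of a period. -/
theorem apply_eq_of_toInterval_eq_one {F : AnalyticLift} (h : toInterval F = 1) {x : ℝ}
    (hx : x ∈ Set.Icc 0 (2 * Real.pi)) : F.1 x = x := by
  have h1 := congrArg (fun f : DiffAnalyticInterval =>
    (f.1 ⟨x / (2 * Real.pi), div_nonneg hx.1 Real.two_pi_pos.le,
      (div_le_one Real.two_pi_pos).2 hx.2⟩ : ℝ)) h
  change F.1 (2 * Real.pi * (x / (2 * Real.pi))) / (2 * Real.pi) = x / (2 * Real.pi) at h1
  rw [mul_div_cancel₀ _ Real.two_pi_pos.ne'] at h1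
  exact (div_left_inj' Real.two_pi_pos.ne').1 h1

/-- The circle map covered by a lift. -/
noncomputable def descend (F : AnalyticLift) (z : Circle) : Circle :=
  Circle.exp (F.1 (Complex.arg z))

theorem descend_exp (F : AnalyticLift) (t : ℝ) :
    descend F (Circle.exp t) = Circle.exp (F.1 t) := by
  obtain ⟨n, hn⟩ := Circle.exp_eq_exp.1 (Circle.exp_arg (Circle.exp t))
  rw [descend, hn, apply_add_int_mul F]
  exact Circle.exp_eq_exp.2 ⟨n, rfl⟩

theorem descend_mul (F K : AnalyticLift) (z : Circle) :
    descend (F * K) z = descend F (descend K z) := by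
  obtain ⟨t, rfl⟩ := Circle.exp_surjective z
  rw [descend_exp, descend_exp, descend_exp]
  rfl

theorem descend_one (z : Circle) : descend 1 z = z := Circle.exp_arg z

theorem contMDiff_descend (F : AnalyticLift) : ContMDiff (𝓡 1) (𝓡 1) ω (descend F) := by
  intro z₀
  obtain ⟨t₀, rfl⟩ := Circle.exp_surjective z₀
  -- The argument is measured from `t₀` instead of `0`: this changes it by a multiple of the period,
  -- and moves the branch cut of the logarithm away from the point considered.
  have heq : descend F = fun z : Circle =>
      Circle.exp (F.1 (t₀ + (Complex.log (z * ((Circle.exp t₀)⁻¹ : Circle))).im)) := by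
    funext z
    rw [← descend_exp, Complex.log_im, Circle.exp_add, ← Circle.coe_mul, Circle.exp_arg,
      mul_comm, inv_mul_cancel_right]
  rw [heq]
  refine contMDiff_circleExp.contMDiffAt.comp _ ?_
  refine (contDiff F).contMDiff.contMDiffAt.comp _ ?_
  have hlog : ContDiffAt ℝ ω (fun w : ℂ =>
      t₀ + (Complex.log (w * ((Circle.exp t₀)⁻¹ : Circle))).im) (Circle.exp t₀) := by
    refine contDiffAt_const.add ?_
    refine ContDiffAt.comp (g := Complex.im)
      (f := fun w : ℂ => Complex.log (w * ((Circle.exp t₀)⁻¹ : Circle))) _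
      Complex.imCLM.contDiff.contDiffAt ?_
    refine ContDiffAt.comp (g := Complex.log)
      (f := fun w : ℂ => w * ((Circle.exp t₀)⁻¹ : Circle)) _ ?_ (contDiffAt_id.mul contDiffAt_const)
    refine (Complex.contDiffAt_log ?_).restrict_scalars ℝ
    simp only [← Circle.coe_mul, mul_inv_cancel, Circle.coe_one, Complex.one_mem_slitPlane]
  exact hlog.contMDiffAt.comp (Circle.exp t₀) contMDiff_coe_circle.contMDiffAt

/-- The diffeomorphism of the circle covered by a lift. -/
noncomputable def toCircle : AnalyticLift →* DiffAnalyticCircle where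
  toFun F :=
    ⟨{ toFun := descend F
       invFun := descend F⁻¹
       left_inv := fun x => by rw [← descend_mul, inv_mul_cancel, descend_one]
       right_inv := fun x => by rw [← descend_mul, mul_inv_cancel, descend_one]
       contMDiff_toFun := contMDiff_descend F
       contMDiff_invFun := contMDiff_descend F⁻¹ }, F.1, descend_exp F⟩
  map_one' := Subtype.ext (Diffeomorph.ext descend_one)
  map_mul' F K := Subtype.ext (Diffeomorph.ext (descend_mul F K))

/-- The projection to the circle is injective. -/
theorem apply_eq_of_toCircle_eq_one {F : AnalyticLift} (h : toCircle F = 1) (x : ℝ) :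
    F.1 x = x := by
  have h1 : DiffAnalyticCircle.IsLift (toCircle F) F.1 := descend_exp F
  rw [h] at h1
  rw [h1.eq_one (apply_zero F)]
  rfl

end AnalyticLift

end AnalyticLift

/-! ### The hyperbolic flow -/

section HyperbolicFlow

/-- The lift to the line of the hyperbolic map `tan (t / 2) ↦ l * tan (t / 2)` of the circle. -/
noncomputable def hyperbolicMap (l t : ℝ) : ℝ :=
  t + 2 * Real.arctan ((l - 1) * Real.sin t / ((1 + l) + (1 - l) * Real.cos t))

/-- The expression is affine in `cos t`, with the values `2 * l` at `-1` and `2` at `1`. -/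
theorem hyperbolicMap_denom_pos {l : ℝ} (hl : 0 < l) (t : ℝ) :
    0 < (1 + l) + (1 - l) * Real.cos t := by
  have h1 := Real.neg_one_le_cos t
  have h2 := Real.cos_le_one t
  rcases h2.lt_or_eq with h | h
  · nlinarith
  · rw [h]; linarith

theorem contDiff_hyperbolicMap {l : ℝ} (hl : 0 < l) : ContDiff ℝ ω (hyperbolicMap l) := by
  refine contDiff_id.add (contDiff_const.mul (Real.contDiff_arctan.comp
    (ContDiff.div ?_ ?_ fun t => (hyperbolicMap_denom_pos hl t).ne')))
  · exact contDiff_const.mul Real.contDiff_sin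
  · exact contDiff_const.add (contDiff_const.mul Real.contDiff_cos)

theorem hyperbolicMap_add_two_pi (l t : ℝ) :
    hyperbolicMap l (t + 2 * Real.pi) = hyperbolicMap l t + 2 * Real.pi := by
  simp only [hyperbolicMap, Real.sin_add_two_pi, Real.cos_add_two_pi]
  ring

theorem hyperbolicMap_zero (l : ℝ) : hyperbolicMap l 0 = 0 := by simp [hyperbolicMap]

theorem hyperbolicMap_pi (l : ℝ) : hyperbolicMap l Real.pi = Real.pi := by simp [hyperbolicMap]

/-- In the coordinate `x = tan (t / 2)` the correction term is `arctan (l * x) - arctan x`, written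
with the subtraction formula. The defining formula shows analyticity and periodicity, this one the
group law. -/
theorem hyperbolicMap_two_mul_arctan {l : ℝ} (hl : 0 < l) (x : ℝ) :
    hyperbolicMap l (2 * Real.arctan x) = 2 * Real.arctan (l * x) := by
  have hx : 0 < 1 + x ^ 2 := by positivity
  have hlx : 0 < 1 + l * x ^ 2 := by positivity
  have hcos : Real.cos (2 * Real.arctan x) = (1 - x ^ 2) / (1 + x ^ 2) := by
    rw [Real.cos_two_mul, Real.cos_sq_arctan]
    field_simp
    ring
  have hsin : Real.sin (2 * Real.arctan x) = 2 * x / (1 + x ^ 2) := by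
    have h1 : Real.sin (Real.arctan x) = x * Real.cos (Real.arctan x) := by
      rw [Real.sin_arctan, Real.cos_arctan]
      ring
    have h2 := Real.cos_sq_arctan x
    rw [Real.sin_two_mul, h1, show 2 * (x * Real.cos (Real.arctan x)) * Real.cos (Real.arctan x)
      = 2 * x * Real.cos (Real.arctan x) ^ 2 by ring, h2]
    field_simp
  have hden : (1 + l) + (1 - l) * ((1 - x ^ 2) / (1 + x ^ 2)) =
      2 * (1 + l * x ^ 2) / (1 + x ^ 2) := by
    field_simp
    ring
  have hq : (l - 1) * (2 * x / (1 + x ^ 2)) / (2 * (1 + l * x ^ 2) / (1 + x ^ 2)) =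
      (l - 1) * x / (1 + l * x ^ 2) := by
    field_simp
  have hxy : x * ((l - 1) * x / (1 + l * x ^ 2)) < 1 := by
    rw [← mul_div_assoc, div_lt_one hlx]
    nlinarith
  have hsum : (x + (l - 1) * x / (1 + l * x ^ 2)) / (1 - x * ((l - 1) * x / (1 + l * x ^ 2))) =
      l * x := by
    have h1 : x + (l - 1) * x / (1 + l * x ^ 2) = l * x * (1 + x ^ 2) / (1 + l * x ^ 2) := by
      field_simp
      ring
    have h2 : 1 - x * ((l - 1) * x / (1 + l * x ^ 2)) = (1 + x ^ 2) / (1 + l * x ^ 2) := by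
      field_simp
      ring
    rw [h1, h2]
    field_simp
  rw [hyperbolicMap, hcos, hsin, hden, hq, ← mul_add, Real.arctan_add hxy, hsum]

/-- Up to the period, the coordinate `tan (t / 2)` misses only `π`, so identities between lifts need
checking only there and in the coordinate. -/
theorem exists_int_mul_add_eq (t : ℝ) : ∃ (n : ℤ) (r : ℝ), t = r + n * (2 * Real.pi) ∧
    (r = Real.pi ∨ ∃ x, r = 2 * Real.arctan x) := by
  obtain ⟨n, ⟨h1, h2⟩, -⟩ := existsUnique_sub_zsmul_mem_Ioc Real.two_pi_pos t (-Real.pi)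
  refine ⟨n, t - n • (2 * Real.pi), by simp, ?_⟩
  generalize t - n • (2 * Real.pi) = r at h1 h2
  rcases h2.eq_or_lt with h | h
  · left; linarith
  · right
    refine ⟨Real.tan (r / 2), ?_⟩
    rw [Real.arctan_tan (by linarith) (by linarith)]
    ring

theorem hyperbolicMap_add_int_mul (l : ℝ) (n : ℤ) (t : ℝ) :
    hyperbolicMap l (t + n * (2 * Real.pi)) = hyperbolicMap l t + n * (2 * Real.pi) := by
  simp only [hyperbolicMap, Real.sin_add_int_mul_two_pi, Real.cos_add_int_mul_two_pi]
  ring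

theorem hyperbolicMap_comp {l m : ℝ} (hl : 0 < l) (hm : 0 < m) (t : ℝ) :
    hyperbolicMap l (hyperbolicMap m t) = hyperbolicMap (l * m) t := by
  obtain ⟨n, r, rfl, rfl | ⟨x, rfl⟩⟩ := exists_int_mul_add_eq t
  · simp only [hyperbolicMap_add_int_mul, hyperbolicMap_pi]
  · simp only [hyperbolicMap_add_int_mul, hyperbolicMap_two_mul_arctan hl,
      hyperbolicMap_two_mul_arctan hm, hyperbolicMap_two_mul_arctan (mul_pos hl hm), mul_assoc]

theorem hyperbolicMap_one (t : ℝ) : hyperbolicMap 1 t = t := by simp [hyperbolicMap]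

theorem hyperbolicMap_exp_comp (s s' t : ℝ) :
    hyperbolicMap (Real.exp s) (hyperbolicMap (Real.exp s') t) =
      hyperbolicMap (Real.exp (s + s')) t := by
  rw [hyperbolicMap_comp (Real.exp_pos _) (Real.exp_pos _), Real.exp_add]

theorem hyperbolicMap_exp_neg_apply (s t : ℝ) :
    hyperbolicMap (Real.exp (-s)) (hyperbolicMap (Real.exp s) t) = t := by
  rw [hyperbolicMap_exp_comp, neg_add_cancel, Real.exp_zero, hyperbolicMap_one]

theorem strictMono_hyperbolicMap (s : ℝ) : StrictMono (hyperbolicMap (Real.exp s)) := by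
  have hinj : Function.Injective (hyperbolicMap (Real.exp s)) :=
    Function.LeftInverse.injective (hyperbolicMap_exp_neg_apply s)
  rcases (contDiff_hyperbolicMap (Real.exp_pos s)).continuous.strictMono_of_inj hinj with h | h
  · exact h
  · have := h Real.pi_pos
    rw [hyperbolicMap_zero, hyperbolicMap_pi] at this
    exact absurd this Real.pi_pos.not_gt

/-- The hyperbolic flow as a one-parameter group of analytic lifts. -/
noncomputable def hyperbolicFlow : Multiplicative ℝ →* AnalyticLift where
  toFun s := ⟨StrictMono.orderIsoOfRightInverse _ (strictMono_hyperbolicMap s.toAdd)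
      (hyperbolicMap (Real.exp (-s.toAdd)))
      (fun t => by simpa using hyperbolicMap_exp_neg_apply (-s.toAdd) t),
    contDiff_hyperbolicMap (Real.exp_pos _), contDiff_hyperbolicMap (Real.exp_pos _),
    hyperbolicMap_add_two_pi _, hyperbolicMap_zero _⟩
  map_one' := by
    apply Subtype.ext
    ext t
    change hyperbolicMap (Real.exp 0) t = t
    rw [Real.exp_zero, hyperbolicMap_one]
  map_mul' s s' := by
    apply Subtype.ext
    ext t
    exact (hyperbolicMap_exp_comp _ _ t).symm

theorem hyperbolicFlow_apply (s : Multiplicative ℝ) (t : ℝ) :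
    (hyperbolicFlow s).1 t = hyperbolicMap (Real.exp s.toAdd) t := rfl

theorem hyperbolicFlow_mem_Ioo (s : Multiplicative ℝ) {t : ℝ} (ht : t ∈ Set.Ioo 0 Real.pi) :
    (hyperbolicFlow s).1 t ∈ Set.Ioo 0 Real.pi := by
  rw [hyperbolicFlow_apply]
  constructor
  · conv_lhs => rw [← hyperbolicMap_zero (Real.exp s.toAdd)]
    exact strictMono_hyperbolicMap _ ht.1
  · conv_rhs => rw [← hyperbolicMap_pi (Real.exp s.toAdd)]
    exact strictMono_hyperbolicMap _ ht.2

/-- On `(0, π)` the flow is multiplication by `exp s` on the positive half-line, which is free. -/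
theorem hyperbolicFlow_apply_ne {s : Multiplicative ℝ} (hs : s ≠ 1) {t : ℝ}
    (ht : t ∈ Set.Ioo 0 Real.pi) : (hyperbolicFlow s).1 t ≠ t := by
  intro h
  rw [hyperbolicFlow_apply] at h
  have ht2 : t = 2 * Real.arctan (Real.tan (t / 2)) := by
    rw [Real.arctan_tan (by linarith [ht.1, Real.pi_pos]) (by linarith [ht.2])]
    ring
  have hpos : 0 < Real.tan (t / 2) :=
    Real.tan_pos_of_pos_of_lt_pi_div_two (by linarith [ht.1]) (by linarith [ht.2])
  rw [ht2, hyperbolicMap_two_mul_arctan (Real.exp_pos _)] at h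
  have h1 := Real.arctan_injective (mul_left_cancel₀ two_ne_zero h)
  have h2 : Real.exp s.toAdd = 1 := by
    exact mul_right_cancel₀ hpos.ne' (by rw [h1, one_mul])
  rw [Real.exp_eq_one_iff] at h2
  exact hs (Multiplicative.toAdd.injective h2)

end HyperbolicFlow

/-! ### A Banach space of analytic perturbations of the identity -/

section Perturbation

theorem summable_perturbation (a : ℕ →ᵇ ℝ) {c : ℝ} (hc : |c| ≤ 1) :
    Summable fun k => a k * (c / 2) ^ k := by
  refine Summable.of_norm_bounded (g := fun k => ‖a‖ * (1 / 2 : ℝ) ^ k)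
    (summable_geometric_two.mul_left _) fun k => ?_
  rw [norm_mul, norm_pow, Real.norm_eq_abs (c / 2), abs_div, abs_two]
  have := a.norm_coe_le_norm k
  gcongr

/-- The perturbation with coefficients `a`, an odd function of period `2π`. -/
noncomputable def perturbation (a : ℕ →ᵇ ℝ) (t : ℝ) : ℝ :=
  Real.sin t * ∑' k, a k * (Real.cos t / 2) ^ k

theorem perturbation_add (a b : ℕ →ᵇ ℝ) (t : ℝ) :
    perturbation (a + b) t = perturbation a t + perturbation b t := by
  simp only [perturbation, ← mul_add, ← (summable_perturbation a (Real.abs_cos_le_one t)).tsum_add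
    (summable_perturbation b (Real.abs_cos_le_one t)), BoundedContinuousFunction.coe_add,
    Pi.add_apply, add_mul]

theorem perturbation_smul (r : ℝ) (a : ℕ →ᵇ ℝ) (t : ℝ) :
    perturbation (r • a) t = r * perturbation a t := by
  simp only [perturbation, BoundedContinuousFunction.coe_smul, smul_eq_mul, mul_assoc,
    tsum_mul_left]
  ring

theorem perturbation_eq_tsum (a : ℕ →ᵇ ℝ) (t : ℝ) :
    perturbation a t = ∑' k, a k * (Real.sin t * (Real.cos t / 2) ^ k) := by
  rw [perturbation, ← tsum_mul_left]
  exact tsum_congr fun k => by ring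

theorem abs_perturbation_le (a : ℕ →ᵇ ℝ) (t : ℝ) : |perturbation a t| ≤ ‖a‖ * 2 := by
  rw [perturbation_eq_tsum, ← Real.norm_eq_abs]
  refine tsum_of_norm_bounded (hasSum_geometric_two.mul_left ‖a‖) fun k => ?_
  rw [norm_mul, norm_mul, norm_pow, Real.norm_eq_abs (Real.cos t / 2), abs_div, abs_two]
  have h1 := a.norm_coe_le_norm k
  have h2 := Real.abs_cos_le_one t
  have h3 : ‖Real.sin t‖ ≤ 1 := Real.abs_sin_le_one t
  calc ‖a k‖ * (‖Real.sin t‖ * (|Real.cos t| / 2) ^ k) ≤ ‖a‖ * (1 * (1 / 2) ^ k) := by gcongr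
    _ = ‖a‖ * (1 / 2) ^ k := by rw [one_mul]

/-- The two terms of the derivative are bounded by `(1 / 2) ^ k` and `k * (1 / 2) ^ k`. These bounds
sum to `4`, the Lipschitz factor of the whole series. -/
theorem abs_sin_mul_cos_pow_sub_le (k : ℕ) (s t : ℝ) :
    |Real.sin t * (Real.cos t / 2) ^ k - Real.sin s * (Real.cos s / 2) ^ k| ≤
      (k + 1) * (1 / 2) ^ k * |t - s| := by
  have hd (x : ℝ) : HasDerivAt (fun x => Real.sin x * (Real.cos x / 2) ^ k)
      (Real.cos x * (Real.cos x / 2) ^ k +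
        Real.sin x * (k * (Real.cos x / 2) ^ (k - 1) * (-Real.sin x / 2))) x :=
    (Real.hasDerivAt_sin x).mul (((Real.hasDerivAt_cos x).div_const 2).pow k)
  refine Convex.norm_image_sub_le_of_norm_deriv_le (fun x _ => (hd x).differentiableAt)
    (fun x _ => ?_) convex_univ (Set.mem_univ s) (Set.mem_univ t)
  rw [(hd x).deriv]
  have h1 := Real.abs_cos_le_one x
  have h2 := Real.abs_sin_le_one x
  have h3 (n : ℕ) : |(Real.cos x / 2) ^ n| ≤ (1 / 2) ^ n := by
    rw [abs_pow, abs_div, abs_two]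
    gcongr
  have h4 : |Real.cos x * (Real.cos x / 2) ^ k| ≤ (1 / 2) ^ k := by
    rw [abs_mul]
    calc |Real.cos x| * |(Real.cos x / 2) ^ k| ≤ 1 * (1 / 2) ^ k := by gcongr; exact h3 k
      _ = _ := one_mul _
  have h5 : |Real.sin x * (k * (Real.cos x / 2) ^ (k - 1) * (-Real.sin x / 2))| ≤
      k * (1 / 2) ^ k := by
    rcases k with _ | k
    · simp
    · rw [abs_mul, abs_mul, abs_mul, Nat.abs_cast, abs_div, abs_neg, abs_two]
      calc |Real.sin x| * ((k + 1 : ℕ) * |(Real.cos x / 2) ^ (k + 1 - 1)| * (|Real.sin x| / 2))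
          ≤ 1 * ((k + 1 : ℕ) * (1 / 2) ^ k * (1 / 2)) := by gcongr; exact h3 k
        _ = _ := by rw [pow_succ]; ring
  exact (abs_add_le _ _).trans ((add_le_add h4 h5).trans_eq (by ring))

theorem abs_perturbation_sub_le (a : ℕ →ᵇ ℝ) (s t : ℝ) :
    |perturbation a t - perturbation a s| ≤ ‖a‖ * 4 * |t - s| := by
  have hsum (t : ℝ) : Summable fun k => a k * (Real.sin t * (Real.cos t / 2) ^ k) := by
    refine ((summable_perturbation a (Real.abs_cos_le_one t)).mul_left (Real.sin t)).congr
      fun k => ?_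
    ring
  rw [perturbation_eq_tsum, perturbation_eq_tsum, ← (hsum t).tsum_sub (hsum s),
    ← Real.norm_eq_abs]
  have h4 : HasSum (fun k : ℕ => (k + 1) * (1 / 2 : ℝ) ^ k) 4 := by
    have h1 := hasSum_coe_mul_geometric_of_norm_lt_one (𝕜 := ℝ) (r := 1 / 2) (by norm_num)
    have h2 := h1.add hasSum_geometric_two
    rw [show (1 / 2 / (1 - 1 / 2) ^ 2 + 2 : ℝ) = 4 by norm_num] at h2
    exact h2.congr_fun fun k => by ring
  have h5 := (h4.mul_left ‖a‖).mul_right |t - s|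
  refine tsum_of_norm_bounded h5 fun k => ?_
  rw [← mul_sub, norm_mul, mul_assoc ‖a‖]
  exact mul_le_mul (a.norm_coe_le_norm k) (abs_sin_mul_cos_pow_sub_le k s t) (norm_nonneg _)
    (norm_nonneg _)

theorem contDiff_perturbation (a : ℕ →ᵇ ℝ) : ContDiff ℝ ω (perturbation a) := by
  let p := FormalMultilinearSeries.ofScalars ℝ fun k => a k * (1 / 2) ^ k
  -- The factor `(1 / 2) ^ k` is there for this: bounded coefficients give radius at least `2`, and
  -- the cosine stays well inside the disc of convergence.
  have hr : ((2 : NNReal) : ENNReal) ≤ p.radius := by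
    refine p.le_radius_of_bound ‖a‖ fun n => ?_
    rw [FormalMultilinearSeries.ofScalars_norm, norm_mul, norm_pow, mul_assoc, ← mul_pow]
    norm_num
    exact a.norm_coe_le_norm n
  have han := (p.hasFPowerSeriesOnBall (lt_of_lt_of_le (by norm_num) hr)).analyticOnNhd
  have hsum (c : ℝ) : p.sum c = ∑' k, a k * (c / 2) ^ k := by
    refine (FormalMultilinearSeries.ofScalars_sum_eq _ c).trans (tsum_congr fun k => ?_)
    rw [smul_eq_mul, mul_assoc, ← mul_pow]
    congr 2
    ring
  have heq : perturbation a = fun t => Real.sin t * p.sum (Real.cos t) := by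
    funext t
    rw [perturbation, hsum]
  rw [heq]
  refine Real.contDiff_sin.mul ?_
  rw [contDiff_omega_iff_analyticOnNhd]
  intro t _
  refine AnalyticAt.comp (han _ ?_) (contDiff_omega_iff_analyticOnNhd.1 Real.contDiff_cos t trivial)
  refine Metric.eball_subset_eball hr ?_
  rw [Metric.eball_coe, Metric.mem_ball, dist_zero_right]
  exact (Real.abs_cos_le_one t).trans_lt (by norm_num)

theorem perturbation_zero_right (a : ℕ →ᵇ ℝ) : perturbation a 0 = 0 := by simp [perturbation]

theorem perturbation_pi (a : ℕ →ᵇ ℝ) : perturbation a Real.pi = 0 := by simp [perturbation]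

theorem perturbation_add_two_pi (a : ℕ →ᵇ ℝ) (t : ℝ) :
    perturbation a (t + 2 * Real.pi) = perturbation a t := by
  simp only [perturbation, Real.sin_add_two_pi, Real.cos_add_two_pi]

/-- The threshold `1 / 8` makes the perturbation Lipschitz with constant `1 / 2`. The resulting
lower bound gives strict monotonicity here and control of the inverse later. -/
theorem le_perturbed_sub {a : ℕ →ᵇ ℝ} (ha : ‖a‖ < 1 / 8) {s t : ℝ} (hst : s ≤ t) :
    (t - s) / 2 ≤ (t + perturbation a t) - (s + perturbation a s) := by
  have h1 := abs_perturbation_sub_le a s t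
  rw [abs_of_nonneg (sub_nonneg.2 hst)] at h1
  have h2 := neg_abs_le (perturbation a t - perturbation a s)
  nlinarith [norm_nonneg a]

theorem strictMono_perturbed {a : ℕ →ᵇ ℝ} (ha : ‖a‖ < 1 / 8) :
    StrictMono fun t => t + perturbation a t := fun s t hst => by
  have := le_perturbed_sub ha hst.le
  have h : s + perturbation a s < t + perturbation a t := by linarith
  exact h

theorem surjective_perturbed (a : ℕ →ᵇ ℝ) :
    Function.Surjective fun t => t + perturbation a t := by
  have hc : Continuous fun t => t + perturbation a t :=
    continuous_id.add (contDiff_perturbation a).continuous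
  refine hc.surjective ?_ ?_
  · exact Filter.tendsto_atTop_add_right_of_le _ (-(‖a‖ * 2)) Filter.tendsto_id
      fun t => (abs_le.1 (abs_perturbation_le a t)).1
  · exact Filter.tendsto_atBot_add_right_of_ge _ (‖a‖ * 2) Filter.tendsto_id
      fun t => (abs_le.1 (abs_perturbation_le a t)).2

theorem contDiff_perturbed (a : ℕ →ᵇ ℝ) : ContDiff ℝ ω fun t => t + perturbation a t :=
  contDiff_id.add (contDiff_perturbation a)

/-- The perturbation of the identity with small coefficients `a`. -/
noncomputable def perturbedLift (a : ℕ →ᵇ ℝ) (ha : ‖a‖ < 1 / 8) : AnalyticLift := by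
  let F : ℝ ≃o ℝ := StrictMono.orderIsoOfSurjective _ (strictMono_perturbed ha)
    (surjective_perturbed a)
  refine ⟨F, contDiff_perturbed a, ?_, fun t => ?_, ?_⟩
  · have hdiff (x : ℝ) : DifferentiableAt ℝ (perturbation a) x :=
      (contDiff_perturbation a).contDiffAt.differentiableAt (by simp)
    refine F.toHomeomorph.contDiff_symm_deriv (f' := fun x => 1 + deriv (perturbation a) x)
      (fun x => ?_) (fun x => (hasDerivAt_id x).add (hdiff x).hasDerivAt) (contDiff_perturbed a)
    have hlip : LipschitzWith (1 / 2) (perturbation a) :=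
      LipschitzWith.of_dist_le_mul fun s t => by
        rw [Real.dist_eq, Real.dist_eq]
        refine (abs_perturbation_sub_le a t s).trans ?_
        refine mul_le_mul_of_nonneg_right ?_ (abs_nonneg _)
        push_cast
        linarith
    have h1 := norm_deriv_le_of_lipschitz (x₀ := x) hlip
    have h2 := neg_abs_le (deriv (perturbation a) x)
    rw [Real.norm_eq_abs] at h1
    push_cast at h1
    have h3 : 0 < 1 + deriv (perturbation a) x := by linarith
    exact h3.ne'
  · change t + 2 * Real.pi + perturbation a (t + 2 * Real.pi) =
      t + perturbation a t + 2 * Real.pi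
    rw [perturbation_add_two_pi]
    ring
  · change 0 + perturbation a 0 = 0
    rw [perturbation_zero_right, add_zero]

open Classical in
/-- The perturbation of the identity with coefficients `a`, if they are small. -/
noncomputable def perturbed (a : ℕ →ᵇ ℝ) : AnalyticLift :=
  -- The default value keeps the parameter space a full Banach space, as Baire's theorem will want;
  -- it is never evaluated inside the ball.
  if ha : ‖a‖ < 1 / 8 then perturbedLift a ha else 1

theorem perturbed_apply {a : ℕ →ᵇ ℝ} (ha : ‖a‖ < 1 / 8) (t : ℝ) :
    (perturbed a).1 t = t + perturbation a t := by
  rw [perturbed, dif_pos ha]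
  rfl

theorem perturbed_apply_pi {a : ℕ →ᵇ ℝ} (ha : ‖a‖ < 1 / 8) : (perturbed a).1 Real.pi = Real.pi := by
  rw [perturbed_apply ha, perturbation_pi, add_zero]

theorem perturbed_mem_Ioo {a : ℕ →ᵇ ℝ} (ha : ‖a‖ < 1 / 8) {t : ℝ} :
    (perturbed a).1 t ∈ Set.Ioo 0 Real.pi ↔ t ∈ Set.Ioo 0 Real.pi := by
  conv_lhs => rw [← AnalyticLift.apply_zero (perturbed a), ← perturbed_apply_pi ha]
  simp only [Set.mem_Ioo, OrderIso.lt_iff_lt]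

/-- There is a perturbation which vanishes at finitely many given points but not at another one. -/
theorem exists_perturbation_eq_zero (P : Finset ℝ) (hP : ∀ p ∈ P, p ∈ Set.Ioo 0 Real.pi) {y : ℝ}
    (hy : y ∈ Set.Ioo 0 Real.pi) (hyP : y ∉ P) :
    ∃ g : ℕ →ᵇ ℝ, (∀ p ∈ P, perturbation g p = 0) ∧ perturbation g y ≠ 0 := by
  -- The perturbation is `sin t` times this polynomial in `cos t`. It does not vanish at `y` since
  -- the cosine is injective on `(0, π)`. The factors `2 ^ k` below undo the normalisation of the
  -- series.
  let q : Polynomial ℝ := ∏ p ∈ P, (Polynomial.X - Polynomial.C (Real.cos p))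
  obtain ⟨C, hC⟩ : ∃ C : ℝ, ∀ k, ‖q.coeff k * 2 ^ k‖ ≤ C := by
    refine ⟨∑ k ∈ q.support, ‖q.coeff k * 2 ^ k‖, fun k => ?_⟩
    by_cases hk : k ∈ q.support
    · exact Finset.single_le_sum (f := fun k => ‖q.coeff k * 2 ^ k‖)
        (fun _ _ => norm_nonneg _) hk
    · rw [Polynomial.notMem_support_iff.1 hk, zero_mul, norm_zero]
      exact Finset.sum_nonneg fun _ _ => norm_nonneg _
  let g : ℕ →ᵇ ℝ := BoundedContinuousFunction.ofNormedAddCommGroupDiscrete _ C hC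
  have hg (t : ℝ) : perturbation g t = Real.sin t * ∏ p ∈ P, (Real.cos t - Real.cos p) := by
    rw [perturbation]
    congr 1
    have h1 (k : ℕ) : g k * (Real.cos t / 2) ^ k = q.coeff k * Real.cos t ^ k := by
      change q.coeff k * 2 ^ k * (Real.cos t / 2) ^ k = _
      rw [mul_assoc, ← mul_pow, mul_div_cancel₀ _ two_ne_zero]
    rw [tsum_congr h1, tsum_eq_sum (s := q.support) (fun k hk => by
      rw [Polynomial.notMem_support_iff.1 hk, zero_mul])]
    change q.sum (fun k c => c * Real.cos t ^ k) = _
    rw [← Polynomial.eval_eq_sum, Polynomial.eval_prod]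
    simp
  refine ⟨g, fun p hp => ?_, ?_⟩
  · rw [hg, Finset.prod_eq_zero hp (sub_self (Real.cos p)), mul_zero]
  · rw [hg]
    refine mul_ne_zero (Real.sin_pos_of_mem_Ioo hy).ne' (Finset.prod_ne_zero_iff.2 fun p hp => ?_)
    intro h
    have := Real.injOn_cos (Set.Ioo_subset_Icc_self hy) (Set.Ioo_subset_Icc_self (hP p hp))
      (sub_eq_zero.1 h)
    exact hyP (this ▸ hp)

end Perturbation

/-! ### Moving the base point by small perturbations -/

section Orbits

variable {ι : Type*} [Fintype ι]

/-- The image of `x₀` under a product of conjugates of elements of the hyperbolic flow by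
perturbations of the identity. -/
noncomputable def orbitPoint (a : ι → ℕ →ᵇ ℝ) (x₀ : ℝ) : List (ι × Multiplicative ℝ) → ℝ
  | [] => x₀
  | p :: L => (perturbed (a p.1)).1
      ((hyperbolicFlow p.2).1 ((perturbed (a p.1)).1.symm (orbitPoint a x₀ L)))

theorem norm_apply_lt {a : ι → ℕ →ᵇ ℝ} (ha : ‖a‖ < 1 / 8) (i : ι) : ‖a i‖ < 1 / 8 :=
  (norm_le_pi_norm a i).trans_lt ha

theorem perturbed_symm_mem_Ioo {a : ℕ →ᵇ ℝ} (ha : ‖a‖ < 1 / 8) {t : ℝ}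
    (ht : t ∈ Set.Ioo 0 Real.pi) : (perturbed a).1.symm t ∈ Set.Ioo 0 Real.pi := by
  rw [← perturbed_mem_Ioo ha, OrderIso.apply_symm_apply]
  exact ht

theorem orbitPoint_mem_Ioo {a : ι → ℕ →ᵇ ℝ} (ha : ‖a‖ < 1 / 8) {x₀ : ℝ}
    (hx₀ : x₀ ∈ Set.Ioo 0 Real.pi) (L : List (ι × Multiplicative ℝ)) :
    orbitPoint a x₀ L ∈ Set.Ioo 0 Real.pi := by
  induction L with
  | nil => exact hx₀
  | cons p L ih =>
    exact (perturbed_mem_Ioo (norm_apply_lt ha _)).2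
      (hyperbolicFlow_mem_Ioo _ (perturbed_symm_mem_Ioo (norm_apply_lt ha _) ih))

/-- All small enough `ε` satisfy the norm conditions, and there are infinitely many of them. -/
theorem exists_small_perturbation [DecidableEq ι] {a : ι → ℕ →ᵇ ℝ} (ha : ‖a‖ < 1 / 8) {δ : ℝ}
    (hδ : 0 < δ) (i : ι) (g : ℕ →ᵇ ℝ) {B : Set ℝ} (hB : B.Finite) :
    ∃ ε : ℝ, ε ∉ B ∧ ‖Function.update a i (a i + ε • g)‖ < 1 / 8 ∧
      ‖Function.update a i (a i + ε • g) - a‖ < δ := by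
  have hc : Continuous fun ε : ℝ => Function.update a i (a i + ε • g) :=
    continuous_const.update i (continuous_const.add (continuous_id.smul continuous_const))
  have h0 : Function.update a i (a i + (0 : ℝ) • g) = a := by simp
  have h1 : ∀ᶠ ε : ℝ in nhds 0, ‖Function.update a i (a i + ε • g)‖ < 1 / 8 :=
    hc.norm.continuousAt.eventually_lt continuousAt_const (by rwa [h0])
  have h2 : ∀ᶠ ε : ℝ in nhds 0, ‖Function.update a i (a i + ε • g) - a‖ < δ :=
    (hc.sub continuous_const).norm.continuousAt.eventually_lt continuousAt_const
      (by
        change ‖Function.update a i (a i + (0 : ℝ) • g) - a‖ < δ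
        rwa [h0, sub_self, norm_zero])
  obtain ⟨ε, hε, hεB⟩ := ((infinite_of_mem_nhds _ (h1.and h2)).sdiff hB).nonempty
  exact ⟨ε, hεB, hε.1, hε.2⟩

theorem perturbed_add_smul_apply {a g : ℕ →ᵇ ℝ} {ε : ℝ} (ha : ‖a‖ < 1 / 8)
    (hag : ‖a + ε • g‖ < 1 / 8) (t : ℝ) :
    (perturbed (a + ε • g)).1 t = (perturbed a).1 t + ε * perturbation g t := by
  rw [perturbed_apply hag, perturbed_apply ha, perturbation_add, perturbation_smul, add_assoc]

/-- Moving one perturbation slightly, with its values at finitely many points fixed, the preimage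
of a further point avoids a finite set. -/
theorem exists_small_perturbation_symm_notMem [DecidableEq ι] {a : ι → ℕ →ᵇ ℝ} (ha : ‖a‖ < 1 / 8)
    {δ : ℝ} (hδ : 0 < δ) (i : ι) {P : Finset ℝ} (hP : ∀ p ∈ P, p ∈ Set.Ioo 0 Real.pi) {x : ℝ}
    (hx : x ∈ Set.Ioo 0 Real.pi) (hxP : ∀ p ∈ P, (perturbed (a i)).1 p ≠ x) {F : Set ℝ}
    (hF : F.Finite) :
    ∃ a' : ι → ℕ →ᵇ ℝ, ‖a'‖ < 1 / 8 ∧ ‖a' - a‖ < δ ∧ (∀ j, j ≠ i → a' j = a j) ∧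
      (∀ p ∈ P, (perturbed (a' i)).1 p = (perturbed (a i)).1 p) ∧
      (perturbed (a' i)).1.symm x ∉ F := by
  have hai := norm_apply_lt ha i
  obtain ⟨g, hgP, hgy⟩ := exists_perturbation_eq_zero P hP (perturbed_symm_mem_Ioo hai hx)
    (fun h => hxP _ h ((perturbed (a i)).1.apply_symm_apply x))
  -- A point `c` of `F` where `g` does not vanish becomes the preimage of `x` for just one `ε`. A
  -- point where `g` vanishes could only be the old preimage, but `g` is nonzero there.
  obtain ⟨ε, hε, h1, h2⟩ := exists_small_perturbation ha hδ i g
    ((hF.image fun c => (x - (perturbed (a i)).1 c) / perturbation g c).insert 0)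
  have hag : ‖a i + ε • g‖ < 1 / 8 := by
    have := norm_apply_lt h1 i
    rwa [Function.update_self] at this
  refine ⟨_, h1, h2, fun j hj => Function.update_of_ne hj _ _, fun p hp => ?_, fun hmem => hε ?_⟩
  · rw [Function.update_self, perturbed_add_smul_apply hai hag, hgP p hp, mul_zero, add_zero]
  · rw [Function.update_self] at hmem
    generalize hc : (perturbed (a i + ε • g)).1.symm x = c at hmem
    rw [OrderIso.symm_apply_eq, perturbed_add_smul_apply hai hag] at hc
    by_cases hgc : perturbation g c = 0
    · rw [hgc, mul_zero, add_zero] at hc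
      rw [hc, OrderIso.symm_apply_apply] at hgy
      exact absurd hgc hgy
    · refine Or.inr ⟨c, hmem, ?_⟩
      rw [hc]
      field_simp
      ring

/-- Moving one perturbation slightly, with its values at finitely many points fixed, the value
at a further point avoids a finite set. -/
theorem exists_small_perturbation_apply_notMem [DecidableEq ι] {a : ι → ℕ →ᵇ ℝ} (ha : ‖a‖ < 1 / 8)
    {δ : ℝ} (hδ : 0 < δ) (i : ι) {P : Finset ℝ} (hP : ∀ p ∈ P, p ∈ Set.Ioo 0 Real.pi) {y : ℝ}
    (hy : y ∈ Set.Ioo 0 Real.pi) (hyP : y ∉ P) {F : Set ℝ} (hF : F.Finite) :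
    ∃ a' : ι → ℕ →ᵇ ℝ, ‖a'‖ < 1 / 8 ∧ ‖a' - a‖ < δ ∧ (∀ j, j ≠ i → a' j = a j) ∧
      (∀ p ∈ P, (perturbed (a' i)).1 p = (perturbed (a i)).1 p) ∧
      (perturbed (a' i)).1 y ∉ F := by
  have hai := norm_apply_lt ha i
  obtain ⟨g, hgP, hgy⟩ := exists_perturbation_eq_zero P hP hy hyP
  obtain ⟨ε, hε, h1, h2⟩ := exists_small_perturbation ha hδ i g
    (hF.image fun c => (c - (perturbed (a i)).1 y) / perturbation g y)
  have hag : ‖a i + ε • g‖ < 1 / 8 := by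
    have := norm_apply_lt h1 i
    rwa [Function.update_self] at this
  refine ⟨_, h1, h2, fun j hj => Function.update_of_ne hj _ _, fun p hp => ?_, fun hmem => hε ?_⟩
  · rw [Function.update_self, perturbed_add_smul_apply hai hag, hgP p hp, mul_zero, add_zero]
  · rw [Function.update_self, perturbed_add_smul_apply hai hag] at hmem
    refine ⟨_, hmem, ?_⟩
    field_simp
    ring

/-- A reduced product of conjugates moves the point `x₀` after a small perturbation. The finite
sets `P i` consist of the points where the perturbations are evaluated along the orbit. -/
theorem exists_orbitPoint_fresh {x₀ : ℝ} (hx₀ : x₀ ∈ Set.Ioo 0 Real.pi)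
    (L : List (ι × Multiplicative ℝ)) (hchain : L.IsChain fun p q => p.1 ≠ q.1)
    (hne : ∀ p ∈ L, p.2 ≠ 1) {a : ι → ℕ →ᵇ ℝ} (ha : ‖a‖ < 1 / 8) {δ : ℝ} (hδ : 0 < δ) :
    ∃ (a' : ι → ℕ →ᵇ ℝ) (P : ι → Finset ℝ), ‖a'‖ < 1 / 8 ∧ ‖a' - a‖ < δ ∧
      (∀ i, ∀ p ∈ P i, p ∈ Set.Ioo 0 Real.pi) ∧
      (∀ a'' : ι → ℕ →ᵇ ℝ,
        (∀ i, ∀ p ∈ P i, (perturbed (a'' i)).1 p = (perturbed (a' i)).1 p) →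
        orbitPoint a'' x₀ L = orbitPoint a' x₀ L) ∧
      (∀ j, (∀ q ∈ L.head?, j ≠ q.1) → ∀ p ∈ P j, (perturbed (a' j)).1 p ≠ orbitPoint a' x₀ L) ∧
      (L ≠ [] → orbitPoint a' x₀ L ≠ x₀) := by
  classical
  induction L generalizing δ with
  | nil =>
    exact ⟨a, fun _ => ∅, ha, by simpa using hδ, by simp, fun _ _ => rfl, by simp, by simp⟩
  | cons q L ih =>
    obtain ⟨i, s⟩ := q
    have hs : s ≠ 1 := hne (i, s) (by simp)
    rw [List.isChain_cons] at hchain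
    obtain ⟨a₀, P, ha₀, hd₀, hP, hagree, hfresh, -⟩ :=
      ih hchain.2 (fun p hp => hne p (List.mem_cons_of_mem _ hp)) (δ := δ / 3) (by linarith)
    set x := orbitPoint a₀ x₀ L with hx
    have hxJ : x ∈ Set.Ioo 0 Real.pi := orbitPoint_mem_Ioo ha₀ hx₀ L
    -- Reducedness enters here: the preceding letter has another index, so `x` is not yet a
    -- prescribed value of the perturbation `i` and its preimage is free to move.
    have hxP : ∀ p ∈ P i, (perturbed (a₀ i)).1 p ≠ x := hfresh i hchain.1
    -- The first move places the preimage `y` so that its image `z` under the flow is not a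
    -- prescribed argument.
    obtain ⟨a₁, ha₁, hd₁, hoff₁, hon₁, hy₁⟩ :=
      exists_small_perturbation_symm_notMem ha₀ (δ := δ / 3) (by linarith) i (hP i) hxJ hxP
        (F := (hyperbolicFlow s).1.symm '' (P i)) ((P i).finite_toSet.image _)
    set y := (perturbed (a₁ i)).1.symm x with hy
    have hyJ : y ∈ Set.Ioo 0 Real.pi := perturbed_symm_mem_Ioo (norm_apply_lt ha₁ i) hxJ
    set z := (hyperbolicFlow s).1 y with hz
    have hzJ : z ∈ Set.Ioo 0 Real.pi := hyperbolicFlow_mem_Ioo s hyJ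
    have hzP : z ∉ insert y (P i) := by
      rw [Finset.mem_insert, not_or]
      refine ⟨hyperbolicFlow_apply_ne hs hyJ, fun h => hy₁ ⟨z, h, ?_⟩⟩
      exact OrderIso.symm_apply_apply _ y
    have hyP' : ∀ p ∈ insert y (P i), p ∈ Set.Ioo 0 Real.pi := by
      intro p hp
      rcases Finset.mem_insert.1 hp with rfl | hp
      · exact hyJ
      · exact hP i p hp
    -- The second move keeps `y ↦ x` and sends `z` away from `x₀` and from every value prescribed so
    -- far, which restores the freshness condition for the next letter.
    obtain ⟨a₂, ha₂, hd₂, hoff₂, hon₂, hz₂⟩ :=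
      exists_small_perturbation_apply_notMem ha₁ (δ := δ / 3) (by linarith) i hyP' hzJ hzP
        (F := insert x₀ (⋃ j, (perturbed (a₀ j)).1 '' (P j)))
        ((Set.finite_iUnion fun j => (P j).finite_toSet.image _).insert x₀)
    have hoff (j : ι) (hj : j ≠ i) : a₂ j = a₀ j := (hoff₂ j hj).trans (hoff₁ j hj)
    have hon (j : ι) (p : ℝ) (hp : p ∈ P j) : (perturbed (a₂ j)).1 p = (perturbed (a₀ j)).1 p := by
      by_cases hj : j = i
      · subst hj
        rw [hon₂ p (Finset.mem_insert_of_mem hp), hon₁ p hp]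
      · rw [hoff j hj]
    have hy₂ : (perturbed (a₂ i)).1 y = x := by
      rw [hon₂ y (Finset.mem_insert_self _ _), hy, OrderIso.apply_symm_apply]
    have horbit (a'' : ι → ℕ →ᵇ ℝ)
        (h : ∀ j, ∀ p ∈ P j, (perturbed (a'' j)).1 p = (perturbed (a₀ j)).1 p)
        (h' : (perturbed (a'' i)).1 y = x) :
        orbitPoint a'' x₀ ((i, s) :: L) = (perturbed (a'' i)).1 z := by
      rw [orbitPoint, hagree a'' h, ← h']
      simp only [OrderIso.symm_apply_apply]
      rfl
    have horbit₂ := horbit a₂ hon hy₂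
    refine ⟨a₂, Function.update P i (insert z (insert y (P i))), ha₂, ?_, ?_, ?_, ?_, ?_⟩
    · calc ‖a₂ - a‖ = ‖(a₂ - a₁) + (a₁ - a₀) + (a₀ - a)‖ := by congr 1; abel
        _ ≤ ‖a₂ - a₁‖ + ‖a₁ - a₀‖ + ‖a₀ - a‖ := norm_add₃_le
        _ < δ := by linarith
    · intro j p hp
      by_cases hj : j = i
      · subst hj
        rw [Function.update_self] at hp
        rcases Finset.mem_insert.1 hp with rfl | hp
        · exact hzJ
        · exact hyP' p hp
      · rw [Function.update_of_ne hj] at hp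
        exact hP j p hp
    · intro a'' h''
      have h1 (p : ℝ) (hp : p ∈ insert z (insert y (P i))) :
          (perturbed (a'' i)).1 p = (perturbed (a₂ i)).1 p :=
        h'' i p (by rwa [Function.update_self])
      rw [horbit₂, ← h1 z (Finset.mem_insert_self _ _)]
      refine horbit a'' (fun j p hp => ?_) ?_
      · rw [← hon j p hp]
        by_cases hj : j = i
        · subst hj
          exact h1 p (Finset.mem_insert_of_mem (Finset.mem_insert_of_mem hp))
        · exact h'' j p (by rwa [Function.update_of_ne hj])
      · rw [h1 y (Finset.mem_insert_of_mem (Finset.mem_insert_self _ _)), hy₂]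
    · intro j hj p hp heq
      have hj : j ≠ i := hj (i, s) rfl
      rw [Function.update_of_ne hj] at hp
      rw [horbit₂, hon j p hp] at heq
      exact hz₂ (Or.inr (Set.mem_iUnion.2 ⟨j, p, hp, heq⟩))
    · intro _ heq
      rw [horbit₂] at heq
      exact hz₂ (Or.inl heq)

end Orbits

/-! ### Baire category and the faithful representation -/

section Embedding

theorem continuous_perturbation : Continuous fun p : (ℕ →ᵇ ℝ) × ℝ => perturbation p.1 p.2 := by
  rw [continuous_iff_continuousAt]
  rintro ⟨a, t⟩
  rw [ContinuousAt, tendsto_iff_dist_tendsto_zero]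
  refine squeeze_zero (g := fun p : (ℕ →ᵇ ℝ) × ℝ => ‖p.1 - a‖ * 2 + ‖a‖ * 4 * |p.2 - t|)
    (fun _ => dist_nonneg) (fun p => ?_) ?_
  · have h1 : perturbation p.1 p.2 = perturbation (p.1 - a) p.2 + perturbation a p.2 := by
      rw [← perturbation_add, sub_add_cancel]
    rw [Real.dist_eq, h1, add_sub_assoc]
    exact (abs_add_le _ _).trans
      (add_le_add (abs_perturbation_le _ _) (abs_perturbation_sub_le _ _ _))
  · have hc : Continuous fun p : (ℕ →ᵇ ℝ) × ℝ => ‖p.1 - a‖ * 2 + ‖a‖ * 4 * |p.2 - t| := by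
      fun_prop
    have := hc.tendsto (a, t)
    simpa using this

/-- By `le_perturbed_sub`, the distance from `y` to a nearby preimage is at most twice the error
made by using `y` as that preimage, and this error tends to zero. -/
theorem continuousOn_perturbed_symm :
    ContinuousOn (fun p : (ℕ →ᵇ ℝ) × ℝ => (perturbed p.1).1.symm p.2) {p | ‖p.1‖ < 1 / 8} := by
  rintro ⟨a, x⟩ ha
  rw [ContinuousWithinAt, tendsto_iff_dist_tendsto_zero]
  set y := (perturbed a).1.symm x with hy
  have hyx : y + perturbation a y = x := by
    rw [← perturbed_apply ha, hy, OrderIso.apply_symm_apply]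
  refine squeeze_zero' (g := fun p : (ℕ →ᵇ ℝ) × ℝ => 2 * |p.2 - (y + perturbation p.1 y)|)
    (Filter.Eventually.of_forall fun _ => dist_nonneg) ?_ ?_
  · filter_upwards [self_mem_nhdsWithin] with p hp
    set y' := (perturbed p.1).1.symm p.2 with hy'
    have hyx' : y' + perturbation p.1 y' = p.2 := by
      rw [← perturbed_apply hp, hy', OrderIso.apply_symm_apply]
    rw [Real.dist_eq, ← hyx']
    rcases le_total y y' with h | h
    · have := le_perturbed_sub hp h
      rw [abs_of_nonneg (sub_nonneg.2 h)]
      have := le_abs_self (y' + perturbation p.1 y' - (y + perturbation p.1 y))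
      linarith
    · have := le_perturbed_sub hp h
      rw [abs_of_nonpos (sub_nonpos.2 h)]
      have := neg_abs_le (y' + perturbation p.1 y' - (y + perturbation p.1 y))
      linarith
  · have hc : Continuous fun p : (ℕ →ᵇ ℝ) × ℝ => 2 * |p.2 - (y + perturbation p.1 y)| :=
      continuous_const.mul (continuous_snd.sub (continuous_const.add
        (continuous_perturbation.comp (continuous_fst.prodMk continuous_const)))).abs
    have := (hc.tendsto (a, x)).mono_left
      (nhdsWithin_le_nhds (s := {p : (ℕ →ᵇ ℝ) × ℝ | ‖p.1‖ < 1 / 8}))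
    simpa only [hyx, sub_self, abs_zero, mul_zero] using this

theorem continuousOn_perturbed :
    ContinuousOn (fun p : (ℕ →ᵇ ℝ) × ℝ => (perturbed p.1).1 p.2) {p | ‖p.1‖ < 1 / 8} :=
  (continuous_snd.add continuous_perturbation).continuousOn.congr
    fun p hp => perturbed_apply hp p.2

theorem continuousOn_orbitPoint {ι : Type*} [Fintype ι] (x₀ : ℝ)
    (L : List (ι × Multiplicative ℝ)) :
    ContinuousOn (fun a : ι → ℕ →ᵇ ℝ => orbitPoint a x₀ L) (Metric.ball 0 (1 / 8)) := by
  have hball (i : ι) (a : ι → ℕ →ᵇ ℝ) (ha : a ∈ Metric.ball 0 (1 / 8)) : ‖a i‖ < 1 / 8 :=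
    norm_apply_lt (mem_ball_zero_iff.1 ha) i
  induction L with
  | nil => exact continuousOn_const
  | cons p L ih =>
    have hi : ContinuousOn (fun a : ι → ℕ →ᵇ ℝ => a p.1) (Metric.ball 0 (1 / 8)) :=
      (continuous_apply p.1).continuousOn
    have h1 : ContinuousOn (fun a : ι → ℕ →ᵇ ℝ => (hyperbolicFlow p.2).1
        ((perturbed (a p.1)).1.symm (orbitPoint a x₀ L))) (Metric.ball 0 (1 / 8)) :=
      (AnalyticLift.contDiff (hyperbolicFlow p.2)).continuous.comp_continuousOn
        (continuousOn_perturbed_symm.comp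
          (f := fun a : ι → ℕ →ᵇ ℝ => (a p.1, orbitPoint a x₀ L)) (hi.prodMk ih) (hball p.1))
    exact continuousOn_perturbed.comp (f := fun a : ι → ℕ →ᵇ ℝ => (a p.1, (hyperbolicFlow p.2).1
        ((perturbed (a p.1)).1.symm (orbitPoint a x₀ L)))) (hi.prodMk h1) (hball p.1)

/-- Baire category: countably many reduced products of conjugates are simultaneously nontrivial
for a suitable choice of the perturbations. -/
theorem exists_forall_orbitPoint_ne {ι κ : Type*} [Fintype ι] [Countable κ] {x₀ : ℝ}
    (hx₀ : x₀ ∈ Set.Ioo 0 Real.pi) (L : κ → List (ι × Multiplicative ℝ)) (hnil : ∀ k, L k ≠ [])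
    (hchain : ∀ k, (L k).IsChain fun p q => p.1 ≠ q.1) (hne : ∀ k, ∀ p ∈ L k, p.2 ≠ 1) :
    ∃ a : ι → ℕ →ᵇ ℝ, ∀ k, orbitPoint a x₀ (L k) ≠ x₀ := by
  -- Adding the exterior of the closed ball makes these sets open and dense in the whole complete
  -- space; the generic point is then taken inside the open ball.
  let U : κ → Set (ι → ℕ →ᵇ ℝ) := fun k =>
    (Metric.ball 0 (1 / 8) ∩ {a | orbitPoint a x₀ (L k) ≠ x₀}) ∪ (Metric.closedBall 0 (1 / 8))ᶜ
  have hopen (k : κ) : IsOpen (U k) :=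
    ((continuousOn_orbitPoint x₀ (L k)).isOpen_inter_preimage Metric.isOpen_ball
      isOpen_ne).union Metric.isClosed_closedBall.isOpen_compl
  have hdense (k : κ) : Dense (U k) := by
    have h1 : Metric.ball 0 (1 / 8) ⊆ closure (U k) := by
      intro a ha
      rw [Metric.mem_closure_iff]
      intro δ hδ
      obtain ⟨a', P, ha', hd, -, -, -, h⟩ := exists_orbitPoint_fresh hx₀ (L k) (hchain k) (hne k)
        (mem_ball_zero_iff.1 ha) hδ
      exact ⟨a', Or.inl ⟨mem_ball_zero_iff.2 ha', h (hnil k)⟩, by rwa [dist_comm, dist_eq_norm]⟩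
    have h2 : Metric.closedBall 0 (1 / 8) ⊆ closure (U k) := by
      rw [← closure_ball _ (by norm_num)]
      exact closure_minimal h1 isClosed_closure
    intro a
    by_cases ha : a ∈ Metric.closedBall 0 (1 / 8)
    · exact h2 ha
    · exact subset_closure (Or.inr ha)
  obtain ⟨a, ha, haU⟩ := (dense_iInter_of_isOpen hopen hdense).exists_mem_open
    (Metric.isOpen_ball (x := (0 : ι → ℕ →ᵇ ℝ)) (ε := 1 / 8)) ⟨0, Metric.mem_ball_self (by norm_num)⟩
  refine ⟨a, fun k => ?_⟩
  rcases Set.mem_iInter.1 ha k with h | h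
  · exact h.2
  · exact absurd (Metric.ball_subset_closedBall haU) h

/-- Finitely many real numbers which are linearly independent over the rationals. -/
theorem exists_linearIndependent_rat_real (V : Type*) [Finite V] :
    ∃ w : V → ℝ, LinearIndependent ℚ w := by
  obtain ⟨s, hs, hli⟩ := exists_set_linearIndependent ℚ ℝ
  rw [Real.rank_rat_real] at hs
  have : Infinite s := by
    rw [Cardinal.infinite_iff, hs]
    exact Cardinal.aleph0_le_continuum
  obtain ⟨f⟩ : Nonempty (V ↪ ℕ) := nonempty_embedding_nat V
  exact ⟨_, hli.comp _ (f.trans (Infinite.natEmbedding s)).injective⟩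

variable {V : Type*} {G : SimpleGraph V}

/-- The subgroup generated by the vertices of a connected component. -/
def RAAG.componentSubgroup (G : SimpleGraph V) (C : G.ConnectedComponent) : Subgroup (RAAG G) :=
  Subgroup.closure (Set.range fun v : {v // G.connectedComponentMk v = C} => RAAG.of G v.1)

/-- Only surjectivity of the free product of the component subgroups is needed: faithfulness will be
seen from the action, not from a normal form. -/
theorem RAAG.exists_coprod_prod_eq (G : SimpleGraph V) (g : RAAG G) :
    ∃ w : Monoid.CoprodI.Word fun C => RAAG.componentSubgroup G C,
      Monoid.CoprodI.lift (fun C => (RAAG.componentSubgroup G C).subtype) w.prod = g := by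
  classical
  have h : g ∈ (Monoid.CoprodI.lift fun C => (RAAG.componentSubgroup G C).subtype).range := by
    have h1 : Subgroup.closure (Set.range (RAAG.of G)) ≤
        (Monoid.CoprodI.lift fun C => (RAAG.componentSubgroup G C).subtype).range := by
      rw [Subgroup.closure_le]
      rintro _ ⟨v, rfl⟩
      refine ⟨Monoid.CoprodI.of (i := G.connectedComponentMk v)
        ⟨RAAG.of G v, Subgroup.subset_closure ⟨⟨v, rfl⟩, rfl⟩⟩, ?_⟩
      rw [Monoid.CoprodI.lift_of]
      rfl
    rw [RAAG.closure_range_of] at h1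
    exact h1 (Subgroup.mem_top g)
  obtain ⟨γ, rfl⟩ := h
  exact ⟨Monoid.CoprodI.Word.equiv γ, 
    congrArg _ (Monoid.CoprodI.Word.equiv.symm_apply_apply γ)⟩

/-- The homomorphism to the additive group of the reals which attaches weights to the vertices. -/
noncomputable def RAAG.weight (G : SimpleGraph V) (w : V → ℝ) : RAAG G →* Multiplicative ℝ :=
  RAAG.lift (fun v => Multiplicative.ofAdd (w v)) fun _ _ _ => mul_comm _ _

/-- The generators of a complete component commute, so `h` is a product of powers of them and its
weight is an integral combination of independent reals; if that is zero, all exponents vanish. -/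
theorem RAAG.weight_ne_one [Finite V] (hG : ∀ C : G.ConnectedComponent, C.toSimpleGraph = ⊤) {w : V → ℝ}
    (hw : LinearIndependent ℚ w) {C : G.ConnectedComponent} {h : RAAG G}
    (hC : h ∈ RAAG.componentSubgroup G C) (h1 : h ≠ 1) : RAAG.weight G w h ≠ 1 := by
  classical
  have := Fintype.ofFinite {v // G.connectedComponentMk v = C}
  let f : {v // G.connectedComponentMk v = C} → RAAG.componentSubgroup G C :=
    fun v => ⟨RAAG.of G v.1, Subgroup.subset_closure ⟨v, rfl⟩⟩
  have hcomm : IsMulCommutative (RAAG.componentSubgroup G C) := by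
    refine Subgroup.isMulCommutative_closure ?_
    rintro _ ⟨u, rfl⟩ _ ⟨v, rfl⟩
    by_cases huv : u.1 = v.1
    · simp only [huv]
    · exact RAAG.of_mul_comm (SimpleGraph.adj_of_toSimpleGraph_eq_top hG huv (u.2.trans v.2.symm))
  have htop : Subgroup.closure (Set.range f) = ⊤ := by
    refine Eq.trans (congrArg _ ?_) (Subgroup.closure_closure_coe_preimage
      (k := Set.range fun v : {v // G.connectedComponentMk v = C} => RAAG.of G v.1))
    refine Set.ext fun x => ?_
    exact exists_congr fun v => Subtype.ext_iff
  let _ : CommGroup (RAAG.componentSubgroup G C) :=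
    { (inferInstance : Group (RAAG.componentSubgroup G C)) with mul_comm := hcomm.is_comm.comm }
  obtain ⟨n, hn⟩ := Subgroup.exists_of_mem_closure_range f (⟨h, hC⟩ : RAAG.componentSubgroup G C)
    (htop ▸ Subgroup.mem_top _)
  intro hτ
  have hsum : ∑ v, (n v : ℚ) • w v.1 = 0 := by
    have h3 := congrArg ((RAAG.weight G w).comp (RAAG.componentSubgroup G C).subtype) hn
    rw [map_prod] at h3
    have h4 : (1 : Multiplicative ℝ) = ∏ v, Multiplicative.ofAdd (w v.1) ^ n v := by
      refine (hτ.symm.trans h3).trans (Finset.prod_congr rfl fun v _ => ?_)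
      rw [map_zpow]
      congr 1
      exact RAAG.lift_of (G := G) _ (fun _ _ _ => mul_comm _ _) v.1
    have h5 := congrArg Multiplicative.toAdd h4
    rw [toAdd_prod, toAdd_one] at h5
    rw [h5]
    refine Finset.sum_congr rfl fun v _ => ?_
    rw [toAdd_zpow, toAdd_ofAdd, zsmul_eq_mul, Rat.smul_def, Rat.cast_intCast]
  have h0 := Fintype.linearIndependent_iff.1 (hw.comp _ Subtype.val_injective) _ hsum
  refine h1 (congrArg Subtype.val (hn.trans (Finset.prod_eq_one fun v _ => ?_)))
  rw [Int.cast_eq_zero.1 (h0 v), zpow_zero]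

/-- The hyperbolic flow conjugated by a perturbation of the identity. -/
noncomputable def conjFlow (a : ℕ →ᵇ ℝ) : Multiplicative ℝ →* AnalyticLift :=
  (MulAut.conj (perturbed a)).toMonoidHom.comp hyperbolicFlow

/-- The representation of a right-angled Artin group by analytic diffeomorphisms in which the
generators of each component lie in a conjugate of the hyperbolic flow. -/
noncomputable def RAAG.toAnalyticLift (G : SimpleGraph V) (w : V → ℝ)
    (a : G.ConnectedComponent → ℕ →ᵇ ℝ) : RAAG G →* AnalyticLift :=
  RAAG.lift (fun v => conjFlow (a (G.connectedComponentMk v)) (Multiplicative.ofAdd (w v)))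
    fun u v huv => by
      rw [SimpleGraph.ConnectedComponent.connectedComponentMk_eq_of_adj huv, ← map_mul, mul_comm,
        map_mul]

/-- On one component the representation factors through the weight, which turns each syllable of a
reduced word into a time of the conjugated flow. -/
theorem RAAG.toAnalyticLift_of_mem (w : V → ℝ) (a : G.ConnectedComponent → ℕ →ᵇ ℝ)
    {C : G.ConnectedComponent} {h : RAAG G} (hC : h ∈ RAAG.componentSubgroup G C) :
    RAAG.toAnalyticLift G w a h = conjFlow (a C) (RAAG.weight G w h) := by
  refine MonoidHom.eqOn_closure (f := RAAG.toAnalyticLift G w a)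
    (g := (conjFlow (a C)).comp (RAAG.weight G w)) ?_ hC
  rintro _ ⟨⟨v, rfl⟩, rfl⟩
  rw [MonoidHom.comp_apply, RAAG.toAnalyticLift, RAAG.weight, RAAG.lift_of, RAAG.lift_of]

/-- Nontrivial elements act on a base point like reduced products of conjugates. -/
theorem RAAG.exists_list_orbitPoint_eq [Finite V] (hG : ∀ C : G.ConnectedComponent, C.toSimpleGraph = ⊤)
    {w : V → ℝ} (hw : LinearIndependent ℚ w) (x₀ : ℝ) {g : RAAG G} (hg : g ≠ 1) :
    ∃ L : List (G.ConnectedComponent × Multiplicative ℝ), L ≠ [] ∧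
      (L.IsChain fun p q => p.1 ≠ q.1) ∧ (∀ p ∈ L, p.2 ≠ 1) ∧
      ∀ a, (RAAG.toAnalyticLift G w a g).1 x₀ = orbitPoint a x₀ L := by
  obtain ⟨W, rfl⟩ := RAAG.exists_coprod_prod_eq G g
  refine ⟨W.toList.map fun p => (p.1, RAAG.weight G w p.2), ?_, ?_, ?_, fun a => ?_⟩
  · intro h
    rw [List.map_eq_nil_iff] at h
    refine hg ?_
    rw [Monoid.CoprodI.Word.prod, h, List.map_nil, List.prod_nil, map_one]
  · rw [List.isChain_map]
    exact W.chain_ne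
  · intro p hp
    obtain ⟨q, hq, rfl⟩ := List.mem_map.1 hp
    exact RAAG.weight_ne_one hG hw q.2.2 fun h => W.ne_one q hq (Subtype.ext h)
  · rw [Monoid.CoprodI.Word.prod]
    generalize W.toList = l
    induction l with
    | nil => simp only [List.map_nil, List.prod_nil, map_one]; rfl
    | cons p l ih =>
      rw [List.map_cons, List.prod_cons, map_mul, map_mul, Monoid.CoprodI.lift_of,
        Subgroup.subtype_apply, RAAG.toAnalyticLift_of_mem w a p.2.2, List.map_cons, orbitPoint,
        ← ih]
      rfl

/-- There is one open dense condition for each nontrivial element, and the group is countable. -/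
theorem RAAG.exists_toAnalyticLift_apply_ne [Finite V]
    (hG : ∀ C : G.ConnectedComponent, C.toSimpleGraph = ⊤) {x₀ : ℝ}
    (hx₀ : x₀ ∈ Set.Ioo 0 Real.pi) :
    ∃ φ : RAAG G →* AnalyticLift, ∀ g, g ≠ 1 → (φ g).1 x₀ ≠ x₀ := by
  have := Fintype.ofFinite G.ConnectedComponent
  obtain ⟨w, hw⟩ := exists_linearIndependent_rat_real V
  choose L hnil hchain hne hL using
    fun g : {g : RAAG G // g ≠ 1} => RAAG.exists_list_orbitPoint_eq hG hw x₀ g.2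
  obtain ⟨a, ha⟩ := exists_forall_orbitPoint_ne hx₀ L hnil hchain hne
  exact ⟨RAAG.toAnalyticLift G w a, fun g hg => by rw [hL ⟨g, hg⟩]; exact ha ⟨g, hg⟩⟩

/-- The base point lies in the period `[0, 2π]`, so moving it is visible on the interval; on the
circle, a lift of the identity that fixes `0` is trivial. -/
theorem embedsIn_interval_and_circle [Finite V] (hG : ∀ C : G.ConnectedComponent, C.toSimpleGraph = ⊤) :
    EmbedsIn (RAAG G) DiffAnalyticInterval ∧ EmbedsIn (RAAG G) DiffAnalyticCircle := by
  have hx₀ : (1 : ℝ) ∈ Set.Ioo 0 Real.pi := ⟨one_pos, by linarith [Real.pi_gt_three]⟩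
  obtain ⟨φ, hφ⟩ := RAAG.exists_toAnalyticLift_apply_ne hG hx₀
  refine ⟨⟨AnalyticLift.toInterval.comp φ, ?_⟩, ⟨AnalyticLift.toCircle.comp φ, ?_⟩⟩
  · refine (injective_iff_map_eq_one _).2 fun g hg => ?_
    by_contra h
    exact hφ g h (AnalyticLift.apply_eq_of_toInterval_eq_one hg
      ⟨hx₀.1.le, by linarith [hx₀.2, Real.pi_pos]⟩)
  · refine (injective_iff_map_eq_one _).2 fun g hg => ?_
    by_contra h
    exact hφ g h (AnalyticLift.apply_eq_of_toCircle_eq_one hg 1)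

end Embedding

theorem mainTheorem1 {V : Type*} [Finite V] (G : SimpleGraph V) :
    (EmbedsIn (RAAG G) DiffAnalyticInterval ↔
      ∀ C : G.ConnectedComponent, C.toSimpleGraph = ⊤) ∧
    (EmbedsIn (RAAG G) DiffAnalyticCircle ↔
      ∀ C : G.ConnectedComponent, C.toSimpleGraph = ⊤) :=
  ⟨⟨toSimpleGraph_eq_top_of_embedsIn_interval, fun h => (embedsIn_interval_and_circle h).1⟩,
    ⟨toSimpleGraph_eq_top_of_embedsIn_circle, fun h => (embedsIn_interval_and_circle h).2⟩⟩
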